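/- Let $\mathbb T^n=(\mathbb R/\mathbb Z)^n$ with Haar measure of mass $1$ and $\mathbb Z^n$ with counting measure. For $(m,w)\in\mathbb Z^n\times\mathbb T^n$ let $T_mg(k)=g(k-m)$, $M_wg(k)=e^{2\pi i w\cdot k}g(k)$ and $V_gf(m,w)=\langle f,M_wT_mg\rangle=\sum_{k\in\mathbb Z^n}f(k)\overline{M_wT_mg(k)}$. Fix non-zero windows $\gamma\in\mathcal S(\mathbb Z^n)$ and $G\in\mathcal S(\mathbb Z^n\times\mathbb T^n)$. A Young function is a convex $\Phi:[0,\infty]\to[0,\infty]$ with $\Phi(0)=0$ and $\lim_{t\to\infty}\Phi(t)=\Phi(\infty)=\infty$. The Orlicz modulation space $M^\Phi(\mathbb Z^n)$ consists of the tempered distributions $f$ on $\mathbb Z^n$ (functions of polynomial growth) with $$\|f\|_{M^\Phi}=\inf\Big\{b>0:\ \sum_{m\in\mathbb Z^n}\int_{\mathbb T^n}\Phi\big(|V_\gamma f(m,w)|/b\big)\,dw\le 1\Big\}<\infty .$$ A function $\varsigma$ on $\mathbb Z^n\times\mathbb T^n$ defining a tempered distribution (that is, $(1+|j|)^{-N}\varsigma(j,\eta)$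 is integrable for some $N$) belongs to $M^1(\mathbb Z^n\times\mathbb T^n)$ if $\|\varsigma\|_{M^1}=\|V_G\varsigma\|_{L^1}<\infty$, where $$V_G\varsigma(m,\omega,\xi,k)=\sum_{j\in\mathbb Z^n}\int_{\mathbb T^n}e^{-2\pi i j\cdot\xi}e^{-2\pi i\eta\cdot k}\varsigma(j,\eta)\overline{G(j-m,\eta-\omega)}\,d\eta .$$ For a compact operator $A$ on $\ell^2(\mathbb Z^n)$ let $s_1(A),s_2(A),\dots$ be the eigenvalues of $|A|=\sqrt{A^*A}$, with multiplicity. For $1\le p<\infty$, $S_p$ is the class of compact operators with $\|A\|_{S_p}=(\sum_i s_i(A)^p)^{1/p}<\infty$; $S_\infty$ is the class of all compact operators, with the operator norm. **Theorem.** Let $\Phi$ be a Young function with $\Phi(x)=-x^2\log x$ for $0\le x\le e^{-3/2}$, and let $\varsigma\in M^1(\mathbb Z^n\times\mathbb T^n)$ and $g\in M^\Phi(\mathbb Z^n)$. Then $$\mathfrak L^{g,g}_\varsigma f(k)=\sum_{m\in\mathbb Z^n}\int_{\mathbb T^n}\varsigma(m,w)\,V_gf(m,w)\,M_wT_mg(k)\,dw,\qquad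 f\in\ell^2(\mathbb Z^n),\ k\in\mathbb Z^n,$$ (all series and integrals converging absolutely) defines a bounded operator on $\ell^2(\mathbb Z^n)$ that lies in $S_p$ for every $1\le p\le\infty$, and $$\|\mathfrak L^{g,g}_\varsigma\|_{S_p}\le 2^{2/p}\,C_{\gamma,G}\,\|\varsigma\|_{M^1}\,\|g\|_{M^\Phi}^2,\qquad C_{\gamma,G}=\frac{\kappa^2}{\|\gamma\|_{\ell^2}^2\,\|G\|_{L^\infty}},\quad \kappa=\tfrac12e^{3/2}+\tfrac14e^{-3/2}$$ (with $2^{2/\infty}=1$). In particular, if the windows that define the two norms are normalized so that $\|\gamma\|_{\ell^2}\ge\kappa$ and $\|G\|_{L^\infty}\ge1$, then $\|\mathfrak L^{g,g}_\varsigma\|_{S_p}\le 2^{2/p}\|\varsigma\|_{M^1}\|g\|_{M^\Phi}^2$. -/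

import Mathlib

open MeasureTheory Filter Topology
open scoped ENNReal NNReal ContDiff ComplexConjugate

namespace LocOp

/-- The lattice `ℤⁿ`, with counting measure; `‖k‖` is the maximum norm on it. -/
abbrev Lat (n : ℕ) := Fin n → ℤ

/-- The torus `𝕋ⁿ = (ℝ/ℤ)ⁿ`. The character `w ↦ exp (2 π i k · w)` is `UnitAddTorus.mFourier k`. -/
abbrev Tor (n : ℕ) := UnitAddTorus (Fin n)

/-- The Haar measure on `𝕋ⁿ` of total mass `1`. -/
noncomputable def torusMeasure (n : ℕ) : Measure (Tor n) :=
  Measure.pi fun _ => AddCircle.haarAddCircle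

/-- The measure `∑_{m ∈ ℤⁿ} ∫_{𝕋ⁿ} dw` on `ℤⁿ × 𝕋ⁿ`. -/
noncomputable def phaseMeasure (n : ℕ) : Measure (Lat n × Tor n) :=
  (Measure.count : Measure (Lat n)).prod (torusMeasure n)

/-- The measure on the dual group `𝕋ⁿ × ℤⁿ` of `ℤⁿ × 𝕋ⁿ`. -/
noncomputable def dualMeasure (n : ℕ) : Measure (Tor n × Lat n) :=
  (torusMeasure n).prod (Measure.count : Measure (Lat n))

/-! ### Functions on the lattice -/

/-- The Schwartz space `𝓢(ℤⁿ)` of rapidly decreasing functions. -/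
def IsSchwartzLat {n : ℕ} (g : Lat n → ℂ) : Prop :=
  ∀ M : ℕ, ∃ C : ℝ, ∀ k, (1 + ‖k‖) ^ M * ‖g k‖ ≤ C

/-- Tempered distributions on `ℤⁿ`: the continuous linear functionals on `𝓢(ℤⁿ)` are exactly the
pairings `φ ↦ ∑ k, f k * φ k` with functions `f` of polynomial growth. -/
def IsTemperedLat {n : ℕ} (f : Lat n → ℂ) : Prop :=
  ∃ (N : ℕ) (C : ℝ), ∀ k, ‖f k‖ ≤ C * (1 + ‖k‖) ^ N

/-- Translation `T_m g (k) = g (k - m)`. -/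
def timeShift {n : ℕ} (m : Lat n) (g : Lat n → ℂ) : Lat n → ℂ := fun k => g (k - m)

/-- Modulation `M_w g (k) = exp (2 π i w · k) g (k)`. -/
noncomputable def freqShift {n : ℕ} (w : Tor n) (g : Lat n → ℂ) : Lat n → ℂ :=
  fun k => UnitAddTorus.mFourier k w * g k

/-- The short-time Fourier transform
`V_g f (m, w) = ⟨f, M_w T_m g⟩ = ∑ k, f k * conj (M_w T_m g k)`. -/
noncomputable def stft {n : ℕ} (g f : Lat n → ℂ) (z : Lat n × Tor n) : ℂ :=
  ∑' k, f k * conj (freqShift z.2 (timeShift z.1 g) k)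

/-! ### Young functions, Orlicz norms and Orlicz modulation spaces -/

/-- Young functions `Φ : [0, ∞] → [0, ∞]`. -/
structure IsYoung (Φ : ℝ≥0∞ → ℝ≥0∞) : Prop where
  convex : ∀ a b : ℝ≥0, a + b = 1 → ∀ x y : ℝ≥0∞, Φ (a * x + b * y) ≤ a * Φ x + b * Φ y
  zero : Φ 0 = 0
  tendsto : Tendsto Φ (𝓝[<] ⊤) (𝓝 ⊤)
  top : Φ ⊤ = ⊤

/-- The condition `Φ x = - x² log x` for `0 ≤ x ≤ exp (-3/2)`. -/
def IsEntropyLike (Φ : ℝ≥0∞ → ℝ≥0∞) : Prop :=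
  ∀ x : ℝ, 0 ≤ x → x ≤ Real.exp (-(3 / 2)) →
    Φ (ENNReal.ofReal x) = ENNReal.ofReal (-(x ^ 2 * Real.log x))

/-- The Luxemburg norm `inf {b > 0 : ∫ Φ (|F| / b) ≤ 1}`. -/
noncomputable def orliczNorm {α : Type*} [MeasurableSpace α] (Φ : ℝ≥0∞ → ℝ≥0∞) (μ : Measure α)
    (F : α → ℂ) : ℝ≥0∞ :=
  sInf {b : ℝ≥0∞ | 0 < b ∧ ∫⁻ x, Φ (‖F x‖ₑ / b) ∂μ ≤ 1}

/-- The norm of `M^Φ(ℤⁿ)` defined by the window `γ`. -/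
noncomputable def orliczModNorm {n : ℕ} (Φ : ℝ≥0∞ → ℝ≥0∞) (γ f : Lat n → ℂ) : ℝ≥0∞ :=
  orliczNorm Φ (phaseMeasure n) (stft γ f)

/-- Membership in the Orlicz modulation space `M^Φ(ℤⁿ)` defined by the window `γ`. -/
def MemOrliczMod {n : ℕ} (Φ : ℝ≥0∞ → ℝ≥0∞) (γ f : Lat n → ℂ) : Prop :=
  IsTemperedLat f ∧ orliczModNorm Φ γ f < ⊤

/-! ### Modulation spaces on `ℤⁿ × 𝕋ⁿ` -/

/-- The Schwartz space `𝓢(ℤⁿ × 𝕋ⁿ)`: smooth in the torus variable, all derivatives rapidly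
decreasing in the lattice variable. Functions on the torus are read as periodic functions. -/
def IsSchwartzPhase {n : ℕ} (G : Lat n × Tor n → ℂ) : Prop :=
  (∀ j : Lat n, ContDiff ℝ ∞ (fun x : Fin n → ℝ => G (j, fun i => (x i : UnitAddCircle)))) ∧
  ∀ M l : ℕ, ∃ C : ℝ, ∀ (j : Lat n) (x : Fin n → ℝ),
    (1 + ‖j‖) ^ M *
      ‖iteratedFDeriv ℝ l (fun y : Fin n → ℝ => G (j, fun i => (y i : UnitAddCircle))) x‖ ≤ C

/-- Functions on `ℤⁿ × 𝕋ⁿ` that define tempered distributions, by integration: those with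
`(1 + |j|)^(-N) F` integrable for some `N`. All of `L¹` and of `L^∞` is of this kind. -/
def IsTemperedPhase {n : ℕ} (F : Lat n × Tor n → ℂ) : Prop :=
  ∃ N : ℕ, Integrable (fun z : Lat n × Tor n => (((1 + ‖z.1‖) ^ N)⁻¹ : ℝ) • F z) (phaseMeasure n)

/-- The short-time Fourier transform on `ℤⁿ × 𝕋ⁿ`, at `((m, ω), (ξ, k))`:
`∑_j ∫ exp (-2 π i j · ξ) exp (-2 π i η · k) F (j, η) conj (G (j - m, η - ω)) dη`. -/
noncomputable def stftPhase {n : ℕ} (G F : Lat n × Tor n → ℂ)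
    (Z : (Lat n × Tor n) × (Tor n × Lat n)) : ℂ :=
  ∫ y : Lat n × Tor n, conj (UnitAddTorus.mFourier y.1 Z.2.1) *
    conj (UnitAddTorus.mFourier Z.2.2 y.2) * F y * conj (G (y - Z.1)) ∂(phaseMeasure n)

/-- The norm of `M^p(ℤⁿ × 𝕋ⁿ)` defined by the window `G`. -/
noncomputable def modNormPhase {n : ℕ} (p : ℝ≥0∞) (G F : Lat n × Tor n → ℂ) : ℝ≥0∞ :=
  eLpNorm (stftPhase G F) p ((phaseMeasure n).prod (dualMeasure n))

/-- Membership of a function in the modulation space `M^p(ℤⁿ × 𝕋ⁿ)` defined by the window `G`. -/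
def MemModPhase {n : ℕ} (p : ℝ≥0∞) (G F : Lat n × Tor n → ℂ) : Prop :=
  IsTemperedPhase F ∧ MemLp (stftPhase G F) p ((phaseMeasure n).prod (dualMeasure n))

/-! ### Localization operators -/

/-- The Hilbert space `ℓ²(ℤⁿ)`. -/
noncomputable abbrev EllTwo (n : ℕ) := lp (fun _ : Lat n => ℂ) 2

/-- `A` is the localization operator with symbol `ς` and windows `g₁, g₂` on `ℓ²(ℤⁿ)`:
`A f (k) = ∑_m ∫ ς (m, w) V_{g₁} f (m, w) M_w T_m g₂ (k) dw`, where all the series and integrals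
converge absolutely. -/
def IsLocalizationOperator {n : ℕ} (ς : Lat n × Tor n → ℂ) (g₁ g₂ : Lat n → ℂ)
    (A : EllTwo n →L[ℂ] EllTwo n) : Prop :=
  ∀ f : EllTwo n,
    (∀ (m : Lat n) (w : Tor n), Summable fun k => f k * conj (freqShift w (timeShift m g₁) k)) ∧
    ∀ k : Lat n,
      Integrable (fun z : Lat n × Tor n => ς z * stft g₁ f z * freqShift z.2 (timeShift z.1 g₂) k)
        (phaseMeasure n) ∧
      A f k = ∫ z : Lat n × Tor n, ς z * stft g₁ f z * freqShift z.2 (timeShift z.1 g₂) k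
        ∂(phaseMeasure n)

/-! ### Schatten classes -/

section Schatten

variable {H : Type*} [NormedAddCommGroup H] [InnerProductSpace ℂ H] [CompleteSpace H]

/-- The multiplicity of `s` as a singular value of the compact operator `A`: the dimension of the
eigenspace of `|A| = √(A* A)` for the eigenvalue `s` (finite if `s ≠ 0`). -/
noncomputable def singularMultiplicity (A : H →L[ℂ] H) (s : ℝ) : ℕ :=
  Module.finrank ℂ (Module.End.eigenspace ((CFC.abs A : H →L[ℂ] H) : H →ₗ[ℂ] H) (s : ℂ))

/-- The Schatten norm of a compact operator: the `ℓ^p` norm of the singular values, counted with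
multiplicity, for `p < ∞`, and the operator norm for `p = ∞`. -/
noncomputable def schattenNorm (p : ℝ≥0∞) (A : H →L[ℂ] H) : ℝ≥0∞ :=
  if p = ⊤ then ‖A‖ₑ
  else (∑' s : Set.Ioi (0 : ℝ),
    (singularMultiplicity A s : ℝ≥0∞) * ENNReal.ofReal s ^ p.toReal) ^ (1 / p.toReal)

/-- The Schatten--von Neumann class `S_p`. -/
def MemSchatten (p : ℝ≥0∞) (A : H →L[ℂ] H) : Prop :=
  IsCompactOperator A ∧ schattenNorm p A < ⊤

end Schatten

/-- The constant `κ² / (‖γ‖₂² ‖G‖_∞)`, with `κ = exp (3/2) / 2 + exp (-3/2) / 4`, that accounts for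
the dependence of the two modulation space norms on their windows. It is at most `1` for windows
normalized so that `‖γ‖₂ ≥ κ` and `‖G‖_∞ ≥ 1`. -/
noncomputable def windowConst {n : ℕ} (γ : Lat n → ℂ) (G : Lat n × Tor n → ℂ) : ℝ≥0∞ :=
  (ENNReal.ofReal (Real.exp (3 / 2) / 2 + Real.exp (-(3 / 2)) / 4) /
    eLpNorm γ 2 Measure.count) ^ 2 / ⨆ z, ‖G z‖ₑ

end LocOp

/-! The operator is the superposition `∫ ς(z) ⟨·, π(z)g⟩ π(z)g dz` of rank one operators, where
`π(z) = M_w T_m` is unitary on `ℓ²`. If `ς ∈ L¹` and `g ∈ ℓ²`, this Bochner integral converges in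
operator norm. It is compact, and its trace norm, hence every `S_p` norm, is at most `‖ς‖₁ ‖g‖₂²`
(`memSchatten_integral_rankOne`). The theorem thus reduces to two embeddings.

`M¹ ⊂ L¹` (`lintegral_mul_iSup_enorm_le_modNormPhase`): `V_G ς(z, ·)` is the Fourier transform of `y
↦ ς(y) conj G(y - z)`, and a function is dominated by the `L¹` norm of its Fourier transform.
Integrating over `z` with `u = y - z` fixed gives `‖ς‖₁ |G(u)| ≤ ‖ς‖_{M¹}`.

`M^Φ ⊂ ℓ²` (`exists_ellTwo_of_memOrliczMod`): let `t = exp (-3/2)`, the inflection point of `-x² log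
x`. By convexity `Φ` lies above its tangent `2tx - t²/2` at `t`, and below `t` it dominates `3x²/2`.
Linear growth alone does not control squares, but on `[0, N]` with `N ≥ t` one gets `(2tN - t²/2) x²
≤ N² Φ(x)`. Let `b` be admissible in the Luxemburg norm and `R = ‖γ‖ ‖g‖ / b`. By Moyal `R` is the
`L²` norm of `V_γ g / b`, and by Cauchy–Schwarz it is also a pointwise bound. If `R ≥ t`, taking `N
= R` gives `(2tR - t²/2) R² ≤ R²`, that is `R ≤ κ`; otherwise `R < t < κ`. That `g ∈ ℓ²` at all
comes from a cruder bound: the tangent line makes `V_γ g(m, ·)` integrable uniformly in `m`, so its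
Fourier coefficients `g(k) conj γ(k - m)`, and with them `g` and `V_γ g`, are bounded. -/

namespace LocOp

/-! ### Singular values and Schatten norms -/

section Schatten

variable {H : Type*} [NormedAddCommGroup H] [InnerProductSpace ℂ H] [CompleteSpace H]

theorem isSymmetric_abs (A : H →L[ℂ] H) :
    ((CFC.abs A : H →L[ℂ] H) : H →ₗ[ℂ] H).IsSymmetric :=
  ContinuousLinearMap.isSelfAdjoint_iff_isSymmetric.mp (CFC.abs_nonneg A).isSelfAdjoint

/-- Both sides are `⟨x, A* A y⟩`. This replaces the polar decomposition: `A` maps orthogonal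
eigenvectors of `|A|` to orthogonal vectors. -/
theorem inner_map_map_eq_inner_abs (A : H →L[ℂ] H) (x y : H) :
    inner ℂ (A x) (A y) = inner ℂ ((CFC.abs A : H →L[ℂ] H) x) ((CFC.abs A : H →L[ℂ] H) y) := by
  have h := congrArg (fun T : H →L[ℂ] H => inner ℂ x (T y)) (CFC.abs_mul_abs A)
  have hs := isSymmetric_abs A x ((CFC.abs A : H →L[ℂ] H) y)
  simp only [mul_apply_eq_comp, ContinuousLinearMap.star_eq_adjoint,
    ContinuousLinearMap.adjoint_inner_right] at h
  rw [← h]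
  exact hs.symm

/-- In infinite dimension `finrank` is `0` and the empty family serves, so eigenspaces can be
handled without knowing that they are finite-dimensional. -/
theorem exists_orthonormal_fin_finrank {V : Type*} [NormedAddCommGroup V] [InnerProductSpace ℂ V] :
    ∃ v : Fin (Module.finrank ℂ V) → V, Orthonormal ℂ v := by
  by_cases h : FiniteDimensional ℂ V
  · exact ⟨stdOrthonormalBasis ℂ V, (stdOrthonormalBasis ℂ V).orthonormal⟩
  · have h0 : Module.finrank ℂ V = 0 := Module.finrank_of_not_finite h
    have : IsEmpty (Fin (Module.finrank ℂ V)) := by rw [h0]; infer_instance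
    exact ⟨fun i => isEmptyElim i, ⟨fun i => isEmptyElim i, fun i => isEmptyElim i⟩⟩

/-- The trace norm is at most the supremum of `∑ i, |⟪f i, A (e i)⟫|` over finite orthonormal
families `e`, `f`. -/
theorem tsum_singularMultiplicity_mul_le (A : H →L[ℂ] H) (C : ℝ≥0∞)
    (h : ∀ (ι : Type) [Fintype ι] (e f : ι → H), Orthonormal ℂ e → Orthonormal ℂ f →
      ∑ i, ‖inner ℂ (f i) (A (e i))‖ₑ ≤ C) :
    ∑' s : Set.Ioi (0 : ℝ), (singularMultiplicity A s : ℝ≥0∞) * ENNReal.ofReal s ≤ C := by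
  rw [ENNReal.tsum_eq_iSup_sum]
  refine iSup_le fun S => ?_
  let T : H →ₗ[ℂ] H := ((CFC.abs A : H →L[ℂ] H) : H →ₗ[ℂ] H)
  have hT : T.IsSymmetric := isSymmetric_abs A
  choose v hv using fun s : S =>
    exists_orthonormal_fin_finrank (V := Module.End.eigenspace T ((s : Set.Ioi (0 : ℝ)) : ℂ))
  have hfam : OrthogonalFamily ℂ
      (fun s : S => Module.End.eigenspace T (((s : Set.Ioi (0 : ℝ)) : ℝ) : ℂ))
      (fun s => (Module.End.eigenspace T _).subtypeₗᵢ) :=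
    hT.orthogonalFamily_eigenspaces.comp
      (f := fun s : S => (((s : Set.Ioi (0 : ℝ)) : ℝ) : ℂ)) (fun a b hab => by
        apply Subtype.ext
        apply Subtype.ext
        exact Complex.ofReal_injective hab)
  have he := hfam.orthonormal_sigma_orthonormal hv
  set e : (Σ s : S, Fin (Module.finrank ℂ
      (Module.End.eigenspace T (((s : Set.Ioi (0 : ℝ)) : ℝ) : ℂ)))) → H :=
    fun a => (v a.1 a.2 : H) with hedef
  replace he : Orthonormal ℂ e := he
  have hpos : ∀ s : S, (0 : ℝ) < ((s : Set.Ioi (0 : ℝ)) : ℝ) := fun s => s.1.2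
  have heig : ∀ a, (CFC.abs A : H →L[ℂ] H) (e a) = (((a.1 : Set.Ioi (0 : ℝ)) : ℝ) : ℂ) • e a :=
    fun a => Module.End.mem_eigenspace_iff.mp (v a.1 a.2).2
  have hin : ∀ a b, inner ℂ (A (e a)) (A (e b)) =
      if a = b then (((a.1 : Set.Ioi (0 : ℝ)) : ℝ) : ℂ) ^ 2 else 0 := by
    intro a b
    rw [inner_map_map_eq_inner_abs, heig, heig, inner_smul_left, inner_smul_right,
      orthonormal_iff_ite.mp he]
    split_ifs with hab
    · subst hab
      rw [Complex.conj_ofReal]; ring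
    · simp
  -- The partial isometry of the polar decomposition applied to `e a`; it makes `⟨f a, A (e a)⟩`
  -- equal to the singular value.
  let f := fun a => ((((a.1 : Set.Ioi (0 : ℝ)) : ℝ) : ℂ)⁻¹) • A (e a)
  have hne : ∀ s : S, (((s : Set.Ioi (0 : ℝ)) : ℝ) : ℂ) ≠ 0 := fun s => by
    exact_mod_cast (hpos s).ne'
  have hf : Orthonormal ℂ f := by
    rw [orthonormal_iff_ite]
    intro a b
    simp only [f, inner_smul_left, inner_smul_right, hin]
    split_ifs with hab
    · subst hab
      rw [map_inv₀, Complex.conj_ofReal]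
      field_simp [hne a.1]
    · simp
  refine le_trans (le_of_eq ?_) (h _ e f he hf)
  have hterm : ∀ a, ‖inner ℂ (f a) (A (e a))‖ₑ =
      ENNReal.ofReal ((a.1 : Set.Ioi (0 : ℝ)) : ℝ) := by
    intro a
    have : inner ℂ (f a) (A (e a)) = (((a.1 : Set.Ioi (0 : ℝ)) : ℝ) : ℂ) := by
      simp only [f, inner_smul_left, hin, if_true]
      rw [map_inv₀, Complex.conj_ofReal]
      field_simp [hne a.1]
    rw [this, ← ofReal_norm, Complex.norm_real, Real.norm_of_nonneg (hpos a.1).le]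
  simp_rw [hterm]
  rw [Fintype.sum_sigma, ← Finset.sum_coe_sort S]
  refine Finset.sum_congr rfl fun s _ => ?_
  simp only [Finset.sum_const, Finset.card_univ, Fintype.card_fin, nsmul_eq_mul]
  rfl

/-- The inclusion `ℓ¹ ⊂ ℓ^q`: every `s i` of positive multiplicity is at most the whole sum `S`, so
`s i ^ q ≤ s i * S ^ (q - 1)`. -/
theorem tsum_natCast_mul_rpow_le {ι : Type*} (m : ι → ℕ) (s : ι → ℝ≥0∞) {q : ℝ} (hq : 1 ≤ q) :
    ∑' i, (m i : ℝ≥0∞) * s i ^ q ≤ (∑' i, (m i : ℝ≥0∞) * s i) ^ q := by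
  set S := ∑' i, (m i : ℝ≥0∞) * s i with hS
  have hsplit : ∀ x : ℝ≥0∞, x ^ q = x * x ^ (q - 1) := fun x => by
    conv_lhs => rw [show q = 1 + (q - 1) by ring]
    rw [ENNReal.rpow_add_of_nonneg _ _ zero_le_one (by linarith), ENNReal.rpow_one]
  rw [hsplit S]
  conv_rhs => rw [hS]
  rw [← ENNReal.tsum_mul_right]
  refine ENNReal.tsum_le_tsum fun i => ?_
  rcases Nat.eq_zero_or_pos (m i) with h0 | h0
  · simp [h0]
  · rw [hsplit (s i), ← mul_assoc]
    have h1 : (1 : ℝ≥0∞) ≤ m i := by exact_mod_cast h0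
    have h2 : s i ≤ S := (le_mul_of_one_le_left' h1).trans (ENNReal.le_tsum i)
    exact mul_le_mul_right (ENNReal.rpow_le_rpow h2 (by linarith)) _

theorem schattenNorm_le_of_tsum_le {A : H →L[ℂ] H} {C : ℝ≥0∞}
    (hA : ∑' s : Set.Ioi (0 : ℝ), (singularMultiplicity A s : ℝ≥0∞) * ENNReal.ofReal s ≤ C)
    (hop : ‖A‖ₑ ≤ C) {p : ℝ≥0∞} (hp : 1 ≤ p) : schattenNorm p A ≤ C := by
  unfold schattenNorm
  split_ifs with hp'
  · exact hop
  have hq : 1 ≤ p.toReal := by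
    rw [← ENNReal.toReal_one]
    exact ENNReal.toReal_mono hp' hp
  have h0 : 0 < p.toReal := by linarith
  calc _ ≤ (C ^ p.toReal) ^ (1 / p.toReal) :=
        ENNReal.rpow_le_rpow ((tsum_natCast_mul_rpow_le _ _ hq).trans
          (ENNReal.rpow_le_rpow hA h0.le)) (by positivity)
    _ = C := by rw [← ENNReal.rpow_mul, mul_one_div_cancel h0.ne', ENNReal.rpow_one]

end Schatten

/-! ### Integrals of rank one operators -/

section RankOneIntegral

variable {H : Type*} [NormedAddCommGroup H] [InnerProductSpace ℂ H] [CompleteSpace H]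
  {Z : Type*} [MeasurableSpace Z] {μ : Measure Z} {v : Z → H} {c : Z → ℂ} {B : ℝ}

/-- The compact operators form a closed subspace; the quotient map by it commutes with the integral
and kills the integrand. -/
theorem isCompactOperator_integral {F : Z → H →L[ℂ] H} (hF : Integrable F μ)
    (hc : ∀ z, IsCompactOperator (F z)) : IsCompactOperator (∫ z, F z ∂μ : H →L[ℂ] H) := by
  let K : Submodule ℂ (H →L[ℂ] H) := compactOperator (RingHom.id ℂ) H H
  have hK : IsClosed (K : Set (H →L[ℂ] H)) := isClosed_setOfPred_isCompactOperator
  have : IsClosed (K.toAddSubgroup : Set (H →L[ℂ] H)) := hK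
  let Q : (H →L[ℂ] H) →L[ℂ] ((H →L[ℂ] H) ⧸ K) := K.mkQL
  have h1 : Q (∫ z, F z ∂μ) = ∫ z, Q (F z) ∂μ := (Q.integral_comp_comm hF).symm
  have h2 : ∀ z, Q (F z) = 0 := fun z => (Submodule.Quotient.mk_eq_zero K).mpr (hc z)
  simp only [h2, integral_zero] at h1
  exact (Submodule.Quotient.mk_eq_zero K).mp h1

omit [CompleteSpace H] in
theorem isCompactOperator_rankOne (x y : H) :
    IsCompactOperator (InnerProductSpace.rankOne ℂ x y : H →L[ℂ] H) := by
  have h : IsCompactOperator (innerSL ℂ y : H →L[ℂ] ℂ) :=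
    isCompactOperator_of_locallyCompactSpace_dom (innerSL ℂ y)
  exact h.clm_comp (ContinuousLinearMap.toSpanSingleton ℂ x)

theorem integrable_smul_rankOne (hv : AEStronglyMeasurable v μ) (hc : Integrable c μ)
    (hB : ∀ z, ‖v z‖ ≤ B) :
    Integrable (fun z => c z • (InnerProductSpace.rankOne ℂ (v z) (v z) : H →L[ℂ] H)) μ := by
  have hm : AEStronglyMeasurable
      (fun z => (InnerProductSpace.rankOne ℂ (v z) (v z) : H →L[ℂ] H)) μ := by
    have : Continuous fun x : H => (InnerProductSpace.rankOne ℂ x x : H →L[ℂ] H) :=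
      (((ContinuousLinearMap.smulRightL ℂ H H).continuous.comp (innerSL ℂ).continuous).clm_apply
        continuous_id)
    exact this.comp_aestronglyMeasurable hv
  refine Integrable.mono' (hc.norm.mul_const (B ^ 2)) (hc.1.smul hm) (.of_forall fun z => ?_)
  rw [norm_smul, InnerProductSpace.norm_rankOne, sq]
  have := hB z
  gcongr
  exact (norm_nonneg _).trans this

-- Bessel's inequality for each family, after `ab ≤ a²/2 + b²/2`. The bound does not depend on the
-- number of vectors.
omit [CompleteSpace H] in
theorem sum_norm_inner_mul_le {ι : Type*} [Fintype ι] {e f : ι → H} (he : Orthonormal ℂ e)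
    (hf : Orthonormal ℂ f) (x : H) :
    ∑ i, ‖inner ℂ x (e i)‖ * ‖inner ℂ (f i) x‖ ≤ ‖x‖ ^ 2 := by
  have h1 := he.sum_inner_products_le x (s := Finset.univ)
  have h2 := hf.sum_inner_products_le x (s := Finset.univ)
  have h3 : ∑ i, ‖inner ℂ x (e i)‖ * ‖inner ℂ (f i) x‖ ≤
      ∑ i, (‖inner ℂ (e i) x‖ ^ 2 / 2 + ‖inner ℂ (f i) x‖ ^ 2 / 2) := by
    refine Finset.sum_le_sum fun i _ => ?_
    rw [norm_inner_symm]
    nlinarith [sq_nonneg (‖inner ℂ (e i) x‖ - ‖inner ℂ (f i) x‖)]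
  rw [Finset.sum_add_distrib, ← Finset.sum_div, ← Finset.sum_div] at h3
  linarith

theorem sum_norm_inner_integral_rankOne_le (hv : AEStronglyMeasurable v μ) (hc : Integrable c μ)
    (hB : ∀ z, ‖v z‖ ≤ B) {ι : Type*} [Fintype ι] {e f : ι → H} (he : Orthonormal ℂ e)
    (hf : Orthonormal ℂ f) :
    ∑ i, ‖inner ℂ (f i)
      ((∫ z, c z • (InnerProductSpace.rankOne ℂ (v z) (v z) : H →L[ℂ] H) ∂μ) (e i))‖ ≤
      (∫ z, ‖c z‖ ∂μ) * B ^ 2 := by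
  have hI := integrable_smul_rankOne hv hc hB
  -- Matrix coefficients are continuous functionals of the operator, so they pass under the
  -- integral.
  let ev : ι → (H →L[ℂ] H) →L[ℂ] ℂ := fun i =>
    (innerSL ℂ (f i)).comp (ContinuousLinearMap.apply ℂ H (e i))
  have hev : ∀ i, Integrable (fun z => c z * (inner ℂ (v z) (e i) * inner ℂ (f i) (v z))) μ := by
    intro i
    refine ((ev i).integrable_comp hI).congr (.of_forall fun z => ?_)
    simp [ev]
  have heq : ∀ i, inner ℂ (f i)
      ((∫ z, c z • (InnerProductSpace.rankOne ℂ (v z) (v z) : H →L[ℂ] H) ∂μ) (e i)) =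
      ∫ z, c z * (inner ℂ (v z) (e i) * inner ℂ (f i) (v z)) ∂μ := by
    intro i
    refine ((ev i).integral_comp_comm hI).symm.trans (integral_congr_ae (.of_forall fun z => ?_))
    simp [ev]
  simp_rw [heq]
  calc _ ≤ ∑ i, ∫ z, ‖c z * (inner ℂ (v z) (e i) * inner ℂ (f i) (v z))‖ ∂μ :=
        Finset.sum_le_sum fun i _ => norm_integral_le_integral_norm _
    _ = ∫ z, ∑ i, ‖c z * (inner ℂ (v z) (e i) * inner ℂ (f i) (v z))‖ ∂μ :=
        (integral_finsetSum _ fun i _ => (hev i).norm).symm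
    _ ≤ ∫ z, ‖c z‖ * B ^ 2 ∂μ := by
        refine integral_mono (integrable_finsetSum _ fun i _ => (hev i).norm)
          (hc.norm.mul_const _) fun z => ?_
        simp only [norm_mul, ← Finset.mul_sum]
        gcongr
        exact (sum_norm_inner_mul_le he hf (v z)).trans (by gcongr; exact hB z)
    _ = _ := integral_mul_const _ _

/-- A superposition of rank one operators `c z • ⟪v z, ·⟫ v z` with integrable `c` and bounded `v`
is compact, and all its Schatten norms are at most `‖c‖₁ (sup ‖v‖)²`. -/
theorem memSchatten_integral_rankOne (hv : AEStronglyMeasurable v μ) (hc : Integrable c μ)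
    (hB : ∀ z, ‖v z‖ ≤ B) {p : ℝ≥0∞} (hp : 1 ≤ p) :
    IsCompactOperator
      (∫ z, c z • (InnerProductSpace.rankOne ℂ (v z) (v z) : H →L[ℂ] H) ∂μ : H →L[ℂ] H) ∧
    schattenNorm p (∫ z, c z • (InnerProductSpace.rankOne ℂ (v z) (v z) : H →L[ℂ] H) ∂μ) ≤
      ENNReal.ofReal ((∫ z, ‖c z‖ ∂μ) * B ^ 2) := by
  have hI := integrable_smul_rankOne hv hc hB
  refine ⟨isCompactOperator_integral hI fun z => (isCompactOperator_rankOne _ _).smul _,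
    schattenNorm_le_of_tsum_le (tsum_singularMultiplicity_mul_le _ _ ?_) ?_ hp⟩
  · intro ι _ e f he hf
    simp_rw [← ofReal_norm]
    rw [← ENNReal.ofReal_sum_of_nonneg fun _ _ => norm_nonneg _]
    exact ENNReal.ofReal_le_ofReal (sum_norm_inner_integral_rankOne_le hv hc hB he hf)
  · rw [← ofReal_norm]
    refine ENNReal.ofReal_le_ofReal ?_
    rw [← integral_mul_const]
    refine norm_integral_le_of_norm_le (hc.norm.mul_const _) (.of_forall fun z => ?_)
    rw [norm_smul, InnerProductSpace.norm_rankOne, sq]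
    have := hB z
    gcongr
    exact (norm_nonneg _).trans this

end RankOneIntegral

/-! ### Lower bounds for entropy-like Young functions -/

section Young

variable {Φ : ℝ≥0∞ → ℝ≥0∞}

/-- Real-valued convexity on the set where `Φ` is finite gives access to slope inequalities. -/
theorem IsYoung.convexOn_toReal (hΦ : IsYoung Φ) :
    ConvexOn ℝ {x : ℝ | 0 ≤ x ∧ Φ (ENNReal.ofReal x) ≠ ⊤}
      fun x => (Φ (ENNReal.ofReal x)).toReal := by
  have key : ∀ x y a b : ℝ, 0 ≤ x → 0 ≤ y → 0 ≤ a → 0 ≤ b → a + b = 1 →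
      Φ (ENNReal.ofReal (a * x + b * y)) ≤ ENNReal.ofReal a * Φ (ENNReal.ofReal x) +
        ENNReal.ofReal b * Φ (ENNReal.ofReal y) := by
    intro x y a b hx hy ha hb hab
    have h := hΦ.convex a.toNNReal b.toNNReal
      (by rw [← Real.toNNReal_add ha hb, hab, Real.toNNReal_one])
      (ENNReal.ofReal x) (ENNReal.ofReal y)
    rw [ENNReal.ofReal_add (by positivity) (by positivity), ENNReal.ofReal_mul ha,
      ENNReal.ofReal_mul hb]
    exact h
  refine ⟨fun x hx y hy a b ha hb hab => ⟨?_, ?_⟩, fun x hx y hy a b ha hb hab => ?_⟩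
  · have := hx.1; have := hy.1
    simp only [smul_eq_mul]; positivity
  · exact ne_top_of_le_ne_top (ENNReal.add_ne_top.mpr ⟨ENNReal.mul_ne_top ENNReal.ofReal_ne_top hx.2,
      ENNReal.mul_ne_top ENNReal.ofReal_ne_top hy.2⟩) (key x y a b hx.1 hy.1 ha hb hab)
  · have h := ENNReal.toReal_mono (ENNReal.add_ne_top.mpr
      ⟨ENNReal.mul_ne_top ENNReal.ofReal_ne_top hx.2,
      ENNReal.mul_ne_top ENNReal.ofReal_ne_top hy.2⟩) (key x y a b hx.1 hy.1 ha hb hab)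
    rw [ENNReal.toReal_add (ENNReal.mul_ne_top ENNReal.ofReal_ne_top hx.2)
      (ENNReal.mul_ne_top ENNReal.ofReal_ne_top hy.2), ENNReal.toReal_mul, ENNReal.toReal_mul,
      ENNReal.toReal_ofReal ha, ENNReal.toReal_ofReal hb] at h
    exact h

/-- The threshold `exp (-3/2)` below which entropy-like Young functions are prescribed. -/
noncomputable def thr : ℝ := Real.exp (-(3 / 2))

theorem thr_pos : 0 < thr := Real.exp_pos _

theorem thr_lt : thr < 1 / 2 := by
  unfold thr
  rw [Real.exp_neg, one_div]
  gcongr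
  have := Real.add_one_lt_exp (show (3 / 2 : ℝ) ≠ 0 by norm_num)
  linarith

/-- The constant `κ = exp (3/2) / 2 + exp (-3/2) / 4`. -/
noncomputable def kap : ℝ := Real.exp (3 / 2) / 2 + Real.exp (-(3 / 2)) / 4

/-- Thus `κ` is where the tangent line at the threshold reaches height `1`, the bound on the modular
in the Luxemburg norm. -/
theorem kap_eq : 2 * thr * kap - thr ^ 2 / 2 = 1 := by
  have h : Real.exp (-(3 / 2)) * Real.exp (3 / 2) = 1 := by rw [← Real.exp_add]; simp
  unfold kap thr
  linear_combination h

theorem thr_lt_kap : thr < kap := by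
  have := kap_eq
  have h1 := thr_pos
  have h2 := thr_lt
  by_contra! h
  nlinarith

/-- The tangent line at `exp (-3/2)` is a lower bound of an entropy-like Young function. -/
theorem IsEntropyLike.ofReal_linear_le (hΦ : IsYoung Φ) (he : IsEntropyLike Φ) {x : ℝ}
    (hx : 0 ≤ x) : ENNReal.ofReal (2 * thr * x - thr ^ 2 / 2) ≤ Φ (ENNReal.ofReal x) := by
  by_cases htop : Φ (ENNReal.ofReal x) = ⊤
  · simp [htop]
  set S := {x : ℝ | 0 ≤ x ∧ Φ (ENNReal.ofReal x) ≠ ⊤}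
  set φ := fun x => (Φ (ENNReal.ofReal x)).toReal with hφ
  have hconv : ConvexOn ℝ S φ := hΦ.convexOn_toReal
  have hval : ∀ y, 0 ≤ y → y ≤ thr → φ y = -(y ^ 2 * Real.log y) := by
    intro y h0 h1
    simp only [hφ, he y h0 h1]
    refine ENNReal.toReal_ofReal ?_
    have := Real.log_nonpos h0 (by linarith [thr_lt])
    nlinarith [sq_nonneg y]
  have hS : ∀ y, 0 ≤ y → y ≤ thr → y ∈ S := fun y h0 h1 => ⟨h0, by
    rw [he y h0 h1]; exact ENNReal.ofReal_ne_top⟩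
  have hlog : Real.log thr = -(3 / 2) := Real.log_exp _
  -- Only the left derivative is available, since `Φ` is prescribed only up to the threshold. Its
  -- value is `-2t log t - t = 3t - t`.
  have hder : HasDerivWithinAt φ (2 * thr) (Set.Iio thr) thr := by
    have h1 : HasDerivAt (fun y : ℝ => -(y ^ 2 * Real.log y)) (2 * thr) thr := by
      convert! (((hasDerivAt_id thr).pow 2).mul (Real.hasDerivAt_log thr_pos.ne')).neg using 1
      simp only [id, hlog]
      field_simp [thr_pos.ne']
      norm_num
      ring
    have hmem : Set.Ioo 0 thr ∈ 𝓝[<] thr := Ioo_mem_nhdsLT thr_pos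
    refine h1.hasDerivWithinAt.congr_of_eventuallyEq ?_ (hval _ thr_pos.le le_rfl)
    filter_upwards [hmem] with y hy using hval y hy.1.le hy.2.le
  have hφthr : φ thr = 3 / 2 * thr ^ 2 := by rw [hval _ thr_pos.le le_rfl, hlog]; ring
  have hxS : x ∈ S := ⟨hx, htop⟩
  have hthrS := hS thr thr_pos.le le_rfl
  rw [ENNReal.ofReal_le_iff_le_toReal htop]
  change _ ≤ φ x
  rcases lt_trichotomy x thr with h | h | h
  · have := hconv.slope_le_of_hasDerivWithinAt_Iio hxS hthrS h hder
    rw [slope_def_field, div_le_iff₀ (by linarith), hφthr] at this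
    nlinarith
  · rw [h, hφthr]; nlinarith
  -- Right of the threshold, chord slopes from the left are at most the slope of the chord to `x`;
  -- let `y` tend to `thr`.
  · have h1 : 2 * thr ≤ (φ x - φ thr) / (x - thr) := by
      have ht := (hasDerivWithinAt_iff_tendsto_slope' (by simp)).mp hder
      refine le_of_tendsto ht ?_
      filter_upwards [Ioo_mem_nhdsLT thr_pos] with y hy
      rw [slope_comm, slope_def_field]
      exact hconv.slope_mono_adjacent (hS y hy.1.le hy.2.le) hxS hy.2 h
    rw [le_div_iff₀ (by linarith), hφthr] at h1
    nlinarith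

theorem IsEntropyLike.ofReal_sq_le (he : IsEntropyLike Φ) {x : ℝ}
    (hx : 0 ≤ x) (hx' : x ≤ thr) : ENNReal.ofReal (3 / 2 * x ^ 2) ≤ Φ (ENNReal.ofReal x) := by
  rw [he x hx hx']
  refine ENNReal.ofReal_le_ofReal ?_
  rcases hx.eq_or_lt with h | h
  · simp [← h]
  · have : Real.log x ≤ -(3 / 2) := by
      rw [← Real.log_exp (-(3 / 2))]
      exact Real.log_le_log h hx'
    nlinarith [sq_nonneg x]

/-- On `[0, N]`, with `N ≥ exp (-3/2)`, an entropy-like Young function dominates a multiple of the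
square. -/
theorem IsEntropyLike.mul_sq_le (hΦ : IsYoung Φ) (he : IsEntropyLike Φ) {x N : ℝ}
    (hx : 0 ≤ x) (hxN : x ≤ N) (hN : thr ≤ N) :
    ENNReal.ofReal (2 * thr * N - thr ^ 2 / 2) * ENNReal.ofReal (x ^ 2) ≤
      ENNReal.ofReal (N ^ 2) * Φ (ENNReal.ofReal x) := by
  have ht := thr_pos
  have hpos : 0 ≤ 2 * thr * N - thr ^ 2 / 2 := by nlinarith
  rw [← ENNReal.ofReal_mul hpos]
  rcases le_total x thr with h | h
  · refine le_trans ?_ (mul_le_mul_right (he.ofReal_sq_le hx h) _)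
    rw [← ENNReal.ofReal_mul (by positivity)]
    refine ENNReal.ofReal_le_ofReal ?_
    -- The difference is `(3N - t)(N - t) / 2`.
    have h1 : 2 * thr * N - thr ^ 2 / 2 ≤ 3 / 2 * N ^ 2 := by nlinarith
    nlinarith [mul_le_mul_of_nonneg_right h1 (sq_nonneg x)]
  · refine le_trans ?_ (mul_le_mul_right (he.ofReal_linear_le hΦ hx) _)
    rw [← ENNReal.ofReal_mul (by positivity)]
    refine ENNReal.ofReal_le_ofReal ?_
    -- The cofactor of `N - x` in `N² (2tx - t²/2) - x² (2tN - t²/2)`.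
    have h1 : 0 ≤ 2 * thr * x * N - thr ^ 2 / 2 * (N + x) := by
      have a1 : thr * x ≤ N * x := by nlinarith
      have a2 : thr * N ≤ x * N := by nlinarith
      nlinarith [mul_le_mul_of_nonneg_left a1 ht.le, mul_le_mul_of_nonneg_left a2 ht.le,
        mul_nonneg (mul_nonneg ht.le hx) (hx.trans hxN)]
    nlinarith [mul_nonneg (sub_nonneg.mpr hxN) h1]

end Young

/-! ### Fourier series on the torus -/

section Torus

variable {n : ℕ}

instance : IsProbabilityMeasure (torusMeasure n) := by
  unfold torusMeasure; infer_instance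

instance : (torusMeasure n).IsAddHaarMeasure := by
  unfold torusMeasure; infer_instance

instance : SigmaFinite (phaseMeasure n) := by
  unfold phaseMeasure; infer_instance

instance : SigmaFinite (dualMeasure n) := by
  unfold dualMeasure; infer_instance

instance : (phaseMeasure n).IsAddLeftInvariant :=
  Measure.prod.instIsAddLeftInvariant

instance : (Measure.count : Measure (Lat n)).IsOpenPosMeasure :=
  ⟨fun U _ hU => by rwa [ne_eq, Measure.count_eq_zero_iff, ← Set.not_nonempty_iff_eq_empty, not_not]⟩

instance : (phaseMeasure n).IsOpenPosMeasure := by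
  unfold phaseMeasure; infer_instance

theorem norm_mFourier_apply (k : Lat n) (w : Tor n) : ‖UnitAddTorus.mFourier k w‖ = 1 := by
  simp only [UnitAddTorus.mFourier, ContinuousMap.coe_mk, norm_prod, fourier_apply,
    Circle.norm_coe, Finset.prod_const_one]

theorem continuous_mFourier_uncurry :
    Continuous fun p : Lat n × Tor n => UnitAddTorus.mFourier p.1 p.2 :=
  continuous_prod_of_discrete_left.mpr fun k => (UnitAddTorus.mFourier k).continuous

theorem integral_conj_mFourier_mul_mFourier (k l : Lat n) :
    ∫ w, conj (UnitAddTorus.mFourier k w) * UnitAddTorus.mFourier l w ∂(torusMeasure n) =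
      if k = l then 1 else 0 := by
  have h := orthonormal_iff_ite.mp (UnitAddTorus.orthonormal_mFourier (d := Fin n)) k l
  rw [ContinuousMap.inner_toLp] at h
  rw [← h]
  refine integral_congr_ae (.of_forall fun w => ?_)
  simp [mul_comm]

/-- The sum of the Fourier series with coefficients `a`. -/
noncomputable def fourierSum (a : Lat n → ℂ) (w : Tor n) : ℂ :=
  ∑' k, a k * conj (UnitAddTorus.mFourier k w)

theorem norm_mul_conj_mFourier (a : Lat n → ℂ) (k : Lat n) (w : Tor n) :
    ‖a k * conj (UnitAddTorus.mFourier k w)‖ = ‖a k‖ := by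
  rw [norm_mul, RCLike.norm_conj, norm_mFourier_apply, mul_one]

variable {a : Lat n → ℂ}

theorem summable_fourierSum (ha : Summable fun k => ‖a k‖) (w : Tor n) :
    Summable fun k => a k * conj (UnitAddTorus.mFourier k w) :=
  Summable.of_norm (by simpa only [norm_mul_conj_mFourier] using ha)

theorem continuous_fourierSum (ha : Summable fun k => ‖a k‖) : Continuous (fourierSum a) :=
  continuous_tsum (fun k => continuous_const.mul
    (Complex.continuous_conj.comp (UnitAddTorus.mFourier k).continuous)) ha
    fun k w => (norm_mul_conj_mFourier a k w).le

theorem integral_fourierSum_mul_mFourier (ha : Summable fun k => ‖a k‖) (l : Lat n) :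
    ∫ w, fourierSum a w * UnitAddTorus.mFourier l w ∂(torusMeasure n) = a l := by
  have hint : ∀ k, Integrable (fun w : Tor n => a k * conj (UnitAddTorus.mFourier k w) *
      UnitAddTorus.mFourier l w) (torusMeasure n) := fun k =>
    Continuous.integrable_of_hasCompactSupport (by fun_prop) (HasCompactSupport.of_compactSpace _)
  have h := hasSum_integral_of_summable_integral_norm hint (by
    simpa [norm_mul, norm_mFourier_apply] using ha)
  have h2 : ∀ k, ∫ w, a k * conj (UnitAddTorus.mFourier k w) * UnitAddTorus.mFourier l w
      ∂(torusMeasure n) = if k = l then a l else 0 := by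
    intro k
    simp_rw [mul_assoc]
    rw [integral_const_mul, integral_conj_mFourier_mul_mFourier]
    split_ifs with hk <;> simp [hk]
  simp_rw [h2] at h
  have h3 := h.unique (hasSum_ite_eq l (a l))
  rw [← h3]
  refine integral_congr_ae (.of_forall fun w => ?_)
  simp only [fourierSum]
  rw [(summable_fourierSum ha w).tsum_mul_right]

theorem enorm_le_lintegral_fourierSum (ha : Summable fun k => ‖a k‖) (l : Lat n) :
    ‖a l‖ₑ ≤ ∫⁻ w, ‖fourierSum a w‖ₑ ∂(torusMeasure n) := by
  conv_lhs => rw [← integral_fourierSum_mul_mFourier ha l]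
  refine (enorm_integral_le_lintegral_enorm _).trans (lintegral_mono fun w => ?_)
  rw [enorm_mul, ← ofReal_norm (UnitAddTorus.mFourier l w), norm_mFourier_apply]
  simp

/-- Parseval's identity for absolutely convergent Fourier series. -/
theorem lintegral_enorm_fourierSum_sq (ha : Summable fun k => ‖a k‖) :
    ∫⁻ w, ‖fourierSum a w‖ₑ ^ 2 ∂(torusMeasure n) = ∑' k, ‖a k‖ₑ ^ 2 := by
  let F : C(Tor n, ℂ) := ⟨fourierSum a, continuous_fourierSum ha⟩
  have h := UnitAddTorus.hasSum_sq_mFourierCoeff (F.toLp 2 (torusMeasure n) ℂ)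
  -- The sign appears because `fourierSum` is built on conjugate characters.
  have hc : ∀ k, UnitAddTorus.mFourierCoeff (F.toLp 2 (torusMeasure n) ℂ) k = a (-k) := by
    intro k
    refine (UnitAddTorus.mFourierCoeff_toLp F k).trans ?_
    rw [← integral_fourierSum_mul_mFourier ha (-k)]
    exact integral_congr_ae (.of_forall fun w => mul_comm _ _)
  have hI : ∫ w, ‖F.toLp 2 (torusMeasure n) ℂ w‖ ^ 2 ∂(torusMeasure n) =
      ∫ w, ‖fourierSum a w‖ ^ 2 ∂(torusMeasure n) := by
    refine integral_congr_ae ?_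
    filter_upwards [ContinuousMap.coeFn_toLp (p := 2) (𝕜 := ℂ) (torusMeasure n) F] with w hw
    rw [hw]; rfl
  have h' : HasSum (fun k => ‖a (-k)‖ ^ 2) (∫ w, ‖fourierSum a w‖ ^ 2 ∂(torusMeasure n)) := by
    rw [← hI]
    exact HasSum.congr_fun h fun k => (congrArg (fun x : ℂ => ‖x‖ ^ 2) (hc k)).symm
  have hint : Integrable (fun w : Tor n => ‖fourierSum a w‖ ^ 2) (torusMeasure n) :=
    Continuous.integrable_of_hasCompactSupport ((continuous_fourierSum ha).norm.pow 2)
      (HasCompactSupport.of_compactSpace _)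
  have e1 : ∫⁻ w, ‖fourierSum a w‖ₑ ^ 2 ∂(torusMeasure n) =
      ENNReal.ofReal (∫ w, ‖fourierSum a w‖ ^ 2 ∂(torusMeasure n)) := by
    rw [ofReal_integral_eq_lintegral_ofReal hint (.of_forall fun w => by positivity)]
    simp_rw [ENNReal.ofReal_pow (norm_nonneg _), ofReal_norm]
  rw [e1, ← h'.tsum_eq, ENNReal.ofReal_tsum_of_nonneg (fun k => by positivity) h'.summable,
    ← (Equiv.neg (Lat n)).tsum_eq]
  simp [ENNReal.ofReal_pow]

/-- Integration against `h` is continuous in the sup norm and vanishes on trigonometric polynomials,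
which are dense. -/
theorem integral_mul_continuousMap_eq_zero {h : Tor n → ℂ} (hh : Integrable h (torusMeasure n))
    (h0 : ∀ k : Lat n, ∫ w, h w * UnitAddTorus.mFourier k w ∂(torusMeasure n) = 0)
    (f : C(Tor n, ℂ)) : ∫ w, h w * f w ∂(torusMeasure n) = 0 := by
  have hint : ∀ f : C(Tor n, ℂ), Integrable (fun w => h w * f w) (torusMeasure n) := fun f =>
    hh.mul_bdd (c := ‖f‖) f.continuous.aestronglyMeasurable (.of_forall f.norm_coe_le_norm)
  let Λ : C(Tor n, ℂ) →ₗ[ℂ] ℂ :=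
    { toFun := fun f => ∫ w, h w * f w ∂(torusMeasure n)
      map_add' := fun f g => by
        simp only [ContinuousMap.add_apply, mul_add]
        exact integral_add (hint f) (hint g)
      map_smul' := fun c f => by
        simp only [ContinuousMap.smul_apply, smul_eq_mul, RingHom.id_apply, mul_left_comm _ c]
        exact integral_const_mul _ _ }
  let Λ' : C(Tor n, ℂ) →L[ℂ] ℂ := Λ.mkContinuous (∫ w, ‖h w‖ ∂(torusMeasure n)) fun f => by
    rw [← integral_mul_const]
    refine norm_integral_le_of_norm_le (hh.norm.mul_const _) (.of_forall fun w => ?_)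
    rw [norm_mul]
    gcongr
    exact f.norm_coe_le_norm w
  have hker : (Submodule.span ℂ (Set.range UnitAddTorus.mFourier)).topologicalClosure ≤
      LinearMap.ker Λ'.toLinearMap := by
    refine Submodule.topologicalClosure_minimal _ ?_ Λ'.isClosed_ker
    rw [Submodule.span_le]
    rintro _ ⟨k, rfl⟩
    exact h0 k
  rw [UnitAddTorus.span_mFourier_closure_eq_top] at hker
  exact hker (Submodule.mem_top (x := f))

/-- Integrable functions on the torus are determined by their Fourier coefficients. -/
theorem ae_eq_zero_of_integral_mul_mFourier {h : Tor n → ℂ} (hh : Integrable h (torusMeasure n))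
    (h0 : ∀ k : Lat n, ∫ w, h w * UnitAddTorus.mFourier k w ∂(torusMeasure n) = 0) :
    h =ᵐ[torusMeasure n] 0 := by
  refine ae_eq_zero_of_forall_setIntegral_isClosed_eq_zero hh fun s hs => ?_
  -- The indicator of a closed set is a pointwise limit of continuous functions bounded by `1`, so
  -- dominated convergence applies.
  have h1 : ∀ N : ℕ, ∫ w, h w * ((hs.apprSeq N w : ℝ) : ℂ) ∂(torusMeasure n) = 0 := fun N =>
    integral_mul_continuousMap_eq_zero hh h0 ⟨fun w => ((hs.apprSeq N w : ℝ) : ℂ), by fun_prop⟩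
  have h2 : Tendsto (fun N : ℕ => ∫ w, h w * ((hs.apprSeq N w : ℝ) : ℂ) ∂(torusMeasure n)) atTop
      (𝓝 (∫ w, s.indicator h w ∂(torusMeasure n))) := by
    refine tendsto_integral_of_dominated_convergence (fun w => ‖h w‖)
      (fun N => hh.1.mul (Continuous.aestronglyMeasurable (by fun_prop))) hh.norm
      (fun N => .of_forall fun w => ?_) (.of_forall fun w => ?_)
    · rw [norm_mul, Complex.norm_real, Real.norm_of_nonneg (NNReal.coe_nonneg _)]
      exact mul_le_of_le_one_right (norm_nonneg _)
        (by exact_mod_cast HasOuterApproxClosed.apprSeq_apply_le_one hs N w)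
    · have ht := tendsto_pi_nhds.mp (HasOuterApproxClosed.tendsto_apprSeq hs) w
      have : Tendsto (fun N => h w * ((hs.apprSeq N w : ℝ) : ℂ)) atTop
          (𝓝 (h w * (((s.indicator (fun _ => (1 : ℝ≥0)) w : ℝ≥0) : ℝ) : ℂ))) :=
        tendsto_const_nhds.mul ((Complex.continuous_ofReal.tendsto _).comp
          ((NNReal.continuous_coe.tendsto _).comp ht))
      convert! this using 2
      by_cases hw : w ∈ s <;> simp [hw]
  simp_rw [h1] at h2
  rw [← integral_indicator hs.measurableSet]
  exact tendsto_nhds_unique h2 tendsto_const_nhds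

/-- An integrable function on the torus is bounded by the sum of its Fourier coefficients. -/
theorem ae_enorm_le_tsum_fourierCoeff {h : Tor n → ℂ} (hh : Integrable h (torusMeasure n)) :
    ∀ᵐ w ∂(torusMeasure n), ‖h w‖ₑ ≤
      ∑' k : Lat n, ‖∫ w, conj (UnitAddTorus.mFourier k w) * h w ∂(torusMeasure n)‖ₑ := by
  let a : Lat n → ℂ := fun k => ∫ w, h w * UnitAddTorus.mFourier k w ∂(torusMeasure n)
  have hsum : ∑' k : Lat n, ‖∫ w, conj (UnitAddTorus.mFourier k w) * h w ∂(torusMeasure n)‖ₑ =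
      ∑' k, ‖a k‖ₑ := by
    rw [← (Equiv.neg (Lat n)).tsum_eq fun k => ‖a k‖ₑ]
    simp only [a, Equiv.neg_apply, UnitAddTorus.mFourier_neg, mul_comm]
  rw [hsum]
  by_cases htop : ∑' k, ‖a k‖ₑ = ⊤
  · simp [htop]
  have ha : Summable fun k => ‖a k‖ := by
    have := ENNReal.summable_toReal htop
    simpa using this
  have hs : Integrable (fourierSum a) (torusMeasure n) :=
    Continuous.integrable_of_hasCompactSupport (continuous_fourierSum ha)
      (HasCompactSupport.of_compactSpace _)
  have hbdd : ∀ {f : Tor n → ℂ} (_ : Integrable f (torusMeasure n)) (k : Lat n),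
      Integrable (fun w => f w * UnitAddTorus.mFourier k w) (torusMeasure n) := fun hf k =>
    hf.mul_bdd (c := 1) (UnitAddTorus.mFourier k).continuous.aestronglyMeasurable
      (.of_forall fun w => (norm_mFourier_apply k w).le)
  -- With summable coefficients the Fourier series converges absolutely, and by uniqueness its sum
  -- is `h` almost everywhere.
  have h0 := ae_eq_zero_of_integral_mul_mFourier (hh.sub hs) fun k => by
    simp only [Pi.sub_apply, sub_mul]
    rw [integral_sub (hbdd hh k) (hbdd hs k), integral_fourierSum_mul_mFourier ha, sub_self]
  filter_upwards [h0] with w hw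
  have : h w = fourierSum a w := sub_eq_zero.mp hw
  rw [this]
  refine (enorm_tsum_le_tsum_enorm).trans (ENNReal.tsum_le_tsum fun k => ?_)
  rw [← ofReal_norm, norm_mul_conj_mFourier, ofReal_norm]

end Torus

/-! ### The embedding of `M¹` into `L¹` on phase space -/

section Phase

variable {n : ℕ}

instance : MeasurableAdd₂ (Lat n × Tor n) where
  measurable_add := (measurable_fst.fst.add measurable_snd.fst).prodMk
    (measurable_fst.snd.add measurable_snd.snd)

instance : MeasurableSub₂ (Lat n × Tor n) where
  measurable_sub := by
    have h1 : ∀ i, Measurable fun p : (Lat n × Tor n) × (Lat n × Tor n) => p.1.1 i - p.2.1 i :=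
      fun i => ((measurable_pi_apply i).comp measurable_fst.fst).sub
        ((measurable_pi_apply i).comp measurable_snd.fst)
    have h2 : ∀ i, Measurable fun p : (Lat n × Tor n) × (Lat n × Tor n) => p.1.2 i - p.2.2 i :=
      fun i => ((measurable_pi_apply i).comp measurable_fst.snd).sub
        ((measurable_pi_apply i).comp measurable_snd.snd)
    exact (measurable_pi_lambda _ h1).prodMk (measurable_pi_lambda _ h2)

theorem ae_phaseMeasure_of_forall {P : Lat n × Tor n → Prop}
    (h : ∀ j, ∀ᵐ w ∂(torusMeasure n), P (j, w)) : ∀ᵐ z ∂(phaseMeasure n), P z := by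
  rw [ae_iff]
  refine measure_mono_null (t := ⋃ j : Lat n, ({j} : Set (Lat n)) ×ˢ {w | ¬ P (j, w)}) ?_
    (measure_iUnion_null fun j => ?_)
  · rintro ⟨j, w⟩ hz
    exact Set.mem_iUnion.mpr ⟨j, rfl, hz⟩
  · rw [phaseMeasure, Measure.prod_prod, ae_iff.mp (h j), mul_zero]

theorem lintegral_phaseMeasure {f : Lat n × Tor n → ℝ≥0∞} (hf : Measurable f) :
    ∫⁻ z, f z ∂(phaseMeasure n) = ∑' m, ∫⁻ w, f (m, w) ∂(torusMeasure n) := by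
  rw [phaseMeasure, lintegral_prod _ hf.aemeasurable, lintegral_count]

/-- An integrable function on `ℤⁿ × 𝕋ⁿ` is bounded by the `L¹` norm of its Fourier transform. -/
theorem ae_enorm_le_lintegral_fourier {h : Lat n × Tor n → ℂ} (hh : Integrable h (phaseMeasure n)) :
    ∀ᵐ y ∂(phaseMeasure n), ‖h y‖ₑ ≤ ∫⁻ ζ : Tor n × Lat n,
      ‖∫ y, conj (UnitAddTorus.mFourier y.1 ζ.1) * conj (UnitAddTorus.mFourier ζ.2 y.2) * h y
        ∂(phaseMeasure n)‖ₑ ∂(dualMeasure n) := by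
  -- Partial Fourier transform in the torus variable. The full transform at `(ξ, k)` is then the
  -- Fourier sum of `c k` at `ξ`, and two one-variable bounds chain: `|h(j, w)| ≤ ∑_k |c k j|`, and
  -- `|c k j|` is at most the `L¹` norm of that sum.
  let c : Lat n → Lat n → ℂ := fun k j =>
    ∫ w, conj (UnitAddTorus.mFourier k w) * h (j, w) ∂(torusMeasure n)
  have hsec : ∀ j, Integrable (fun w => h (j, w)) (torusMeasure n) :=
    Measure.ae_count_iff.mp hh.prod_right_ae
  have hsum : ∀ k, Summable fun j => ‖c k j‖ := by
    intro k
    have h1 := integrable_count_iff.mp hh.integral_norm_prod_left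
    refine Summable.of_nonneg_of_le (fun _ => norm_nonneg _) (fun j => ?_) h1
    refine (norm_integral_le_integral_norm _).trans (le_trans (le_of_eq ?_) (le_abs_self _))
    refine integral_congr_ae (.of_forall fun w => ?_)
    simp [norm_mFourier_apply]
  have hFT : ∀ ζ : Tor n × Lat n, ∫ y, conj (UnitAddTorus.mFourier y.1 ζ.1) *
      conj (UnitAddTorus.mFourier ζ.2 y.2) * h y ∂(phaseMeasure n) =
      fourierSum (c ζ.2) ζ.1 := by
    intro ζ
    have hi : Integrable (fun y : Lat n × Tor n => conj (UnitAddTorus.mFourier y.1 ζ.1) *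
        conj (UnitAddTorus.mFourier ζ.2 y.2) * h y) (phaseMeasure n) := by
      refine hh.bdd_mul (c := 1) (Continuous.aestronglyMeasurable ?_) (.of_forall fun y => ?_)
      · exact continuous_prod_of_discrete_left.mpr fun k => by fun_prop
      · simp [norm_mFourier_apply]
    rw [phaseMeasure] at hi ⊢
    rw [integral_prod _ hi, integral_countable hi.integral_prod_left]
    refine tsum_congr fun j => ?_
    simp only [mul_assoc]
    rw [integral_const_mul]
    simp [c, Measure.real, mul_comm]
  have hmeas : Measurable fun ζ : Tor n × Lat n => ‖fourierSum (c ζ.2) ζ.1‖ₑ :=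
    (continuous_prod_of_discrete_right (f := fun ζ : Tor n × Lat n =>
      fourierSum (c ζ.2) ζ.1)).mpr
      (fun k => continuous_fourierSum (hsum k)) |>.measurable.enorm
  simp_rw [hFT]
  rw [dualMeasure, lintegral_prod_symm _ hmeas.aemeasurable, lintegral_count]
  refine ae_phaseMeasure_of_forall fun j => ?_
  filter_upwards [ae_enorm_le_tsum_fourierCoeff (hsec j)] with w hw
  exact hw.trans (ENNReal.tsum_le_tsum fun k => enorm_le_lintegral_fourierSum (hsum k) j)

theorem measurable_stftPhase_integrand {F G : Lat n × Tor n → ℂ} (hF : Measurable F)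
    (hG : Continuous G) :
    Measurable fun p : ((Lat n × Tor n) × (Tor n × Lat n)) × (Lat n × Tor n) =>
      conj (UnitAddTorus.mFourier p.2.1 p.1.2.1) * conj (UnitAddTorus.mFourier p.1.2.2 p.2.2) *
        F p.2 * conj (G (p.2 - p.1.1)) := by
  have hm : Measurable fun p : Lat n × Tor n => UnitAddTorus.mFourier p.1 p.2 :=
    continuous_mFourier_uncurry.measurable
  have hs : Measurable fun p : (Lat n × Tor n) × (Lat n × Tor n) => G (p.1 - p.2) :=
    hG.measurable.comp (measurable_fst.sub measurable_snd)
  have hc : Measurable (conj : ℂ → ℂ) := Complex.continuous_conj.measurable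
  refine Measurable.mul (Measurable.mul (Measurable.mul (hc.comp ?_) (hc.comp ?_)) ?_) (hc.comp ?_)
  · exact hm.comp (f := fun p : ((Lat n × Tor n) × (Tor n × Lat n)) × (Lat n × Tor n) =>
      (p.2.1, p.1.2.1)) (by fun_prop)
  · exact hm.comp (f := fun p : ((Lat n × Tor n) × (Tor n × Lat n)) × (Lat n × Tor n) =>
      (p.1.2.2, p.2.2)) (by fun_prop)
  · exact hF.comp measurable_snd
  · exact hs.comp (f := fun p : ((Lat n × Tor n) × (Tor n × Lat n)) × (Lat n × Tor n) =>
      (p.2, p.1.1)) (by fun_prop)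

/-- Fourier inversion in `y` for each fixed `z`, then integration over `z` along `y = z + u`. This
gives the bound for almost every `u`; continuity of `G` extends it to all `u`. -/
theorem lintegral_mul_enorm_le_modNormPhase_of_measurable {F G : Lat n × Tor n → ℂ}
    (hF : Measurable F) (hG : Continuous G)
    (hint : ∀ z, Integrable (fun y => F y * conj (G (y - z))) (phaseMeasure n))
    (u : Lat n × Tor n) :
    (∫⁻ z, ‖F z‖ₑ ∂(phaseMeasure n)) * ‖G u‖ₑ ≤ modNormPhase 1 G F := by
  have hV : Measurable (stftPhase G F) :=
    (measurable_stftPhase_integrand hF hG).stronglyMeasurable.integral_prod_right.measurable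
  let I : Lat n × Tor n → ℝ≥0∞ := fun z => ∫⁻ ζ, ‖stftPhase G F (z, ζ)‖ₑ ∂(dualMeasure n)
  have hI : Measurable I := hV.enorm.lintegral_prod_right'
  have hmod : modNormPhase 1 G F = ∫⁻ z, I z ∂(phaseMeasure n) := by
    rw [modNormPhase, eLpNorm_one_eq_lintegral_enorm, lintegral_prod _ hV.enorm.aemeasurable]
  have hz : ∀ z, ∀ᵐ y ∂(phaseMeasure n), ‖F y‖ₑ * ‖G (y - z)‖ₑ ≤ I z := by
    intro z
    filter_upwards [ae_enorm_le_lintegral_fourier (hint z)] with y hy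
    rw [enorm_mul, ← ofReal_norm (conj _), RCLike.norm_conj, ofReal_norm] at hy
    refine hy.trans (le_of_eq (lintegral_congr fun ζ => ?_))
    simp only [stftPhase, mul_assoc]
  have hshift : ∀ z, ∀ᵐ u ∂(phaseMeasure n), ‖F (z + u)‖ₑ * ‖G u‖ₑ ≤ I z := by
    intro z
    have := (measurePreserving_add_left (phaseMeasure n) z).quasiMeasurePreserving.ae (hz z)
    filter_upwards [this] with u hu
    simpa using hu
  have hset : MeasurableSet {p : (Lat n × Tor n) × (Lat n × Tor n) |
      ‖F (p.1 + p.2)‖ₑ * ‖G p.2‖ₑ ≤ I p.1} := by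
    have hadd : Measurable fun p : (Lat n × Tor n) × (Lat n × Tor n) => p.1 + p.2 :=
      measurable_fst.add measurable_snd
    exact measurableSet_le ((hF.comp hadd).enorm.mul (hG.measurable.comp measurable_snd).enorm)
      (hI.comp measurable_fst)
  -- The exceptional null set of `u` depends on `z`; Fubini exchanges the two quantifiers.
  have hswap := (Measure.ae_ae_comm (μ := phaseMeasure n) (ν := phaseMeasure n)
    (p := fun z u => ‖F (z + u)‖ₑ * ‖G u‖ₑ ≤ I z) hset).mp (.of_forall hshift)
  have hae : ∀ᵐ u ∂(phaseMeasure n), (∫⁻ z, ‖F z‖ₑ ∂(phaseMeasure n)) * ‖G u‖ₑ ≤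
      modNormPhase 1 G F := by
    filter_upwards [hswap] with u hu
    have hsh : ∫⁻ z, ‖F z‖ₑ ∂(phaseMeasure n) = ∫⁻ z, ‖F (z + u)‖ₑ ∂(phaseMeasure n) :=
      ((measurePreserving_add_right (phaseMeasure n) u).lintegral_comp hF.enorm).symm
    rw [hmod, hsh, ← lintegral_mul_const' _ _ enorm_ne_top]
    exact lintegral_mono_ae hu
  -- Multiplication by `∞` is not continuous, so this case is separate: a good point in the open set
  -- `G ≠ 0` forces the right side to be infinite.
  by_cases htop : ∫⁻ z, ‖F z‖ₑ ∂(phaseMeasure n) = ⊤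
  · rcases eq_or_ne (G u) 0 with h0 | h0
    · simp [h0]
    obtain ⟨u', hu', h1⟩ := (Measure.dense_of_ae hae).inter_open_nonempty _
      (isOpen_compl_singleton.preimage hG) ⟨u, h0⟩
    have h2 : ‖G u'‖ₑ ≠ 0 := by simpa using hu'
    have h3 : modNormPhase 1 G F = ⊤ := by
      simpa [htop, ENNReal.top_mul h2] using h1
    simp [h3]
  have hcl : IsClosed {u | (∫⁻ z, ‖F z‖ₑ ∂(phaseMeasure n)) * ‖G u‖ₑ ≤ modNormPhase 1 G F} :=
    isClosed_le ((ENNReal.continuous_const_mul htop).comp hG.enorm) continuous_const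
  have := (Measure.dense_of_ae hae).closure_eq
  rw [hcl.closure_eq] at this
  exact this.ge (Set.mem_univ u)

theorem continuous_of_continuous_comp_mk {f : Tor n → ℂ}
    (hf : Continuous fun x : Fin n → ℝ => f fun i => (x i : UnitAddCircle)) : Continuous f := by
  have hq : IsOpenQuotientMap fun (x : Fin n → ℝ) (i : Fin n) => (x i : UnitAddCircle) :=
    IsOpenQuotientMap.piMap fun _ => QuotientAddGroup.isOpenQuotientMap_mk
  exact hq.isQuotientMap.continuous_iff.mpr hf

theorem IsSchwartzPhase.continuous {G : Lat n × Tor n → ℂ} (hG : IsSchwartzPhase G) :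
    Continuous G :=
  continuous_prod_of_discrete_left.mpr fun j => continuous_of_continuous_comp_mk (hG.1 j).continuous

theorem IsSchwartzPhase.exists_bound {G : Lat n × Tor n → ℂ} (hG : IsSchwartzPhase G) (N : ℕ) :
    ∃ C : ℝ, ∀ z, (1 + ‖z.1‖) ^ N * ‖G z‖ ≤ C := by
  obtain ⟨C, hC⟩ := hG.2 N 0
  refine ⟨C, fun ⟨j, w⟩ => ?_⟩
  choose x hx using fun i => QuotientAddGroup.mk_surjective (w i)
  have h := hC j x
  rw [norm_iteratedFDeriv_zero] at h
  have hw : (fun i => (x i : UnitAddCircle)) = w := funext hx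
  rwa [hw] at h

/-- The decay of `G` absorbs the polynomial weight through `1 + |y| ≤ (1 + |z|)(1 + |y - z|)`. -/
theorem integrable_mul_conj_sub {F G : Lat n × Tor n → ℂ} (hF : IsTemperedPhase F)
    (hG : IsSchwartzPhase G) (z : Lat n × Tor n) :
    Integrable (fun y => F y * conj (G (y - z))) (phaseMeasure n) := by
  obtain ⟨N, hN⟩ := hF
  obtain ⟨C, hC⟩ := hG.exists_bound N
  have hpos : ∀ j : Lat n, (0 : ℝ) < (1 + ‖j‖) ^ N := fun j => by positivity
  have hb := hN.mul_bdd (c := (1 + ‖z.1‖) ^ N * C)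
    (g := fun y => (((1 + ‖y.1‖) ^ N : ℝ) : ℂ) * conj (G (y - z))) ?_ (.of_forall fun y => ?_)
  · refine hb.congr (.of_forall fun y => ?_)
    have h1 : (((1 + ‖y.1‖) ^ N : ℝ) : ℂ) ≠ 0 := by exact_mod_cast (hpos y.1).ne'
    simp only [Complex.real_smul, Complex.ofReal_inv]
    field_simp
  · have := hG.continuous
    exact Continuous.aestronglyMeasurable (by fun_prop)
  · rw [norm_mul, RCLike.norm_conj, Complex.norm_real, Real.norm_of_nonneg (hpos _).le]
    have h1 : 1 + ‖y.1‖ ≤ (1 + ‖z.1‖) * (1 + ‖(y - z).1‖) := by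
      have : ‖y.1‖ ≤ ‖z.1‖ + ‖(y - z).1‖ := by
        have := norm_add_le z.1 (y - z).1
        simpa using this
      nlinarith [mul_nonneg (norm_nonneg z.1) (norm_nonneg (y - z).1)]
    calc (1 + ‖y.1‖) ^ N * ‖G (y - z)‖
        ≤ ((1 + ‖z.1‖) * (1 + ‖(y - z).1‖)) ^ N * ‖G (y - z)‖ := by gcongr
      _ = (1 + ‖z.1‖) ^ N * ((1 + ‖(y - z).1‖) ^ N * ‖G (y - z)‖) := by rw [mul_pow]; ring
      _ ≤ _ := by gcongr; exact hC _

theorem IsTemperedPhase.aestronglyMeasurable {F : Lat n × Tor n → ℂ} (hF : IsTemperedPhase F) :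
    AEStronglyMeasurable F (phaseMeasure n) := by
  obtain ⟨N, hN⟩ := hF
  have hc : AEStronglyMeasurable (fun z : Lat n × Tor n => ((1 + ‖z.1‖) ^ N : ℝ))
      (phaseMeasure n) := Continuous.aestronglyMeasurable (by fun_prop)
  refine (hc.smul hN.1).congr (.of_forall fun z => ?_)
  have : (0 : ℝ) < (1 + ‖z.1‖) ^ N := by positivity
  simp only [Pi.smul_apply', smul_smul, mul_inv_cancel₀ this.ne', one_smul]

/-- `M¹(ℤⁿ × 𝕋ⁿ)` embeds into `L¹(ℤⁿ × 𝕋ⁿ)`. -/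
theorem lintegral_mul_iSup_enorm_le_modNormPhase {F G : Lat n × Tor n → ℂ} (hF : IsTemperedPhase F)
    (hG : IsSchwartzPhase G) :
    (∫⁻ z, ‖F z‖ₑ ∂(phaseMeasure n)) * ⨆ z, ‖G z‖ₑ ≤ modNormPhase 1 G F := by
  -- Passing to a measurable representative changes `stftPhase` at no point, since it is an
  -- integral.
  have hm := hF.aestronglyMeasurable
  have hae : F =ᵐ[phaseMeasure n] hm.mk F := hm.ae_eq_mk
  have h1 : ∫⁻ z, ‖F z‖ₑ ∂(phaseMeasure n) = ∫⁻ z, ‖hm.mk F z‖ₑ ∂(phaseMeasure n) :=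
    lintegral_congr_ae (hae.fun_comp _)
  have h2 : stftPhase G F = stftPhase G (hm.mk F) := by
    funext Z
    refine integral_congr_ae ?_
    filter_upwards [hae] with y hy
    rw [hy]
  have h3 : modNormPhase 1 G F = modNormPhase 1 G (hm.mk F) := by rw [modNormPhase, h2, modNormPhase]
  rw [h1, h3, ENNReal.mul_iSup]
  refine iSup_le fun u => lintegral_mul_enorm_le_modNormPhase_of_measurable
    hm.stronglyMeasurable_mk.measurable hG.continuous (fun z => ?_) u
  refine (integrable_mul_conj_sub hF hG z).congr ?_
  filter_upwards [hae] with y hy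
  rw [hy]

end Phase

/-! ### Summability on the lattice -/

section Lattice

variable {n : ℕ}

theorem tsum_prod_apply (f : ℤ → ℝ≥0∞) :
    ∀ n : ℕ, ∑' k : Fin n → ℤ, ∏ i, f (k i) = (∑' j, f j) ^ n
  | 0 => by simp
  | n + 1 => by
    rw [← (Fin.consEquiv fun _ : Fin (n + 1) => ℤ).tsum_eq, ENNReal.tsum_prod']
    simp only [Fin.consEquiv_apply, Fin.prod_univ_succ, Fin.cons_zero, Fin.cons_succ,
      ENNReal.tsum_mul_left, tsum_prod_apply f n, ENNReal.tsum_mul_right, pow_succ']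

theorem summable_inv_one_add_abs_sq : Summable fun j : ℤ => ((1 + |(j : ℝ)|) ^ 2)⁻¹ := by
  have h : Summable fun j : ℕ => ((1 + (j : ℝ)) ^ 2)⁻¹ := by
    have := (summable_nat_add_iff 1).mpr (Real.summable_nat_pow_inv (p := 2) |>.mpr (by norm_num))
    simpa [add_comm] using this
  exact Summable.of_nat_of_neg (by simpa using h) (by simpa using h)

/-- Comparison with `∏ i, (1 + |k i|)⁻²`, whose sum factors into one-dimensional sums. -/
theorem summable_inv_one_add_norm_pow (n : ℕ) :
    Summable fun k : Lat n => ((1 + ‖k‖) ^ (2 * n))⁻¹ := by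
  let f : ℤ → ℝ := fun j => ((1 + |(j : ℝ)|) ^ 2)⁻¹
  have hf : ∀ j, 0 ≤ f j := fun j => by positivity
  have hfin : ∑' k : Lat n, ENNReal.ofReal (∏ i, f (k i)) ≠ ⊤ := by
    simp_rw [ENNReal.ofReal_prod_of_nonneg fun i _ => hf _]
    rw [tsum_prod_apply fun j => ENNReal.ofReal (f j)]
    exact ENNReal.pow_ne_top summable_inv_one_add_abs_sq.tsum_ofReal_ne_top
  have hs : Summable fun k : Lat n => ∏ i, f (k i) := by
    have := ENNReal.summable_toReal hfin
    refine this.congr fun k => ?_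
    exact ENNReal.toReal_ofReal (Finset.prod_nonneg fun i _ => hf _)
  refine Summable.of_nonneg_of_le (fun k => by positivity) (fun k => ?_) hs
  rw [Finset.prod_inv_distrib]
  have hpos : ∀ i, 0 < (1 + |(k i : ℝ)|) ^ 2 := fun i => by positivity
  refine inv_anti₀ (Finset.prod_pos fun i _ => hpos i) ?_
  calc ∏ i, (1 + |(k i : ℝ)|) ^ 2 ≤ ∏ _i : Fin n, (1 + ‖k‖) ^ 2 := by
        refine Finset.prod_le_prod (fun i _ => (hpos i).le) fun i _ => ?_
        have : |(k i : ℝ)| ≤ ‖k‖ := by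
          rw [← Int.norm_eq_abs]
          exact norm_le_pi_norm k i
        gcongr
    _ = (1 + ‖k‖) ^ (2 * n) := by simp [pow_mul]

theorem IsSchwartzLat.summable {γ : Lat n → ℂ} (hγ : IsSchwartzLat γ) (N : ℕ) :
    Summable fun k => (1 + ‖k‖) ^ N * ‖γ k‖ := by
  obtain ⟨C, hC⟩ := hγ (2 * n + N)
  refine Summable.of_nonneg_of_le (fun k => by positivity) (fun k => ?_)
    ((summable_inv_one_add_norm_pow n).mul_left C)
  have h := hC k
  have hpos : 0 < (1 + ‖k‖) ^ (2 * n) := by positivity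
  rw [← div_eq_mul_inv, le_div_iff₀ hpos]
  calc (1 + ‖k‖) ^ N * ‖γ k‖ * (1 + ‖k‖) ^ (2 * n) = (1 + ‖k‖) ^ (2 * n + N) * ‖γ k‖ := by
        rw [pow_add]; ring
    _ ≤ C := h

theorem IsSchwartzLat.summable_norm {γ : Lat n → ℂ} (hγ : IsSchwartzLat γ) :
    Summable fun k => ‖γ k‖ := by
  simpa using hγ.summable 0

theorem summable_norm_mul_conj_shift {γ g : Lat n → ℂ} (hγ : IsSchwartzLat γ) (hg : IsTemperedLat g)
    (m : Lat n) : Summable fun k => ‖g k * conj (γ (k - m))‖ := by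
  obtain ⟨N, C, hC⟩ := hg
  have h := ((Equiv.subRight m).summable_iff.mpr (hγ.summable N)).mul_left
    (C * (1 + ‖m‖) ^ N)
  have hC0 : 0 ≤ C := by
    have := (norm_nonneg _).trans (hC 0)
    simpa using this
  refine Summable.of_nonneg_of_le (fun _ => norm_nonneg _) (fun k => ?_) h
  rw [norm_mul, RCLike.norm_conj]
  simp only [Function.comp_apply, Equiv.subRight_apply]
  have h1 : 1 + ‖k‖ ≤ (1 + ‖m‖) * (1 + ‖k - m‖) := by
    have : ‖k‖ ≤ ‖m‖ + ‖k - m‖ := by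
      have := norm_add_le m (k - m)
      simpa using this
    nlinarith [mul_nonneg (norm_nonneg m) (norm_nonneg (k - m))]
  calc ‖g k‖ * ‖γ (k - m)‖ ≤ C * (1 + ‖k‖) ^ N * ‖γ (k - m)‖ := by gcongr; exact hC k
    _ ≤ C * ((1 + ‖m‖) * (1 + ‖k - m‖)) ^ N * ‖γ (k - m)‖ := by gcongr
    _ = _ := by rw [mul_pow]; ring

/-- For fixed `m` the transform is a Fourier series in `w`, which brings in the torus estimates. -/
theorem stft_eq_fourierSum (γ g : Lat n → ℂ) (m : Lat n) (w : Tor n) :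
    stft γ g (m, w) = fourierSum (fun k => g k * conj (γ (k - m))) w := by
  refine tsum_congr fun k => ?_
  simp only [freqShift, timeShift, map_mul]
  ring

end Lattice

/-! ### Time-frequency shifts on `ℓ²` -/

section EllTwo

variable {n : ℕ}

theorem enorm_sq_eq_tsum (f : EllTwo n) : ‖f‖ₑ ^ 2 = ∑' k, ‖f k‖ₑ ^ 2 := by
  have h : ‖f‖ ^ 2 = ∑' k, ‖f k‖ ^ 2 := by
    have := lp.norm_rpow_eq_tsum (p := 2) (by norm_num) f
    simpa using this
  have hs : Summable fun k => ‖f k‖ ^ 2 := by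
    have := (lp.memℓp f).summable (by norm_num)
    simpa using this
  rw [← ofReal_norm, ← ENNReal.ofReal_pow (norm_nonneg _), h,
    ENNReal.ofReal_tsum_of_nonneg (fun k => by positivity) hs]
  simp_rw [ENNReal.ofReal_pow (norm_nonneg _), ofReal_norm]

theorem memℓp_two_of_tsum_ne_top {f : Lat n → ℂ} (hf : ∑' k, ‖f k‖ₑ ^ 2 ≠ ⊤) : Memℓp f 2 := by
  refine memℓp_gen ?_
  have := ENNReal.summable_toReal hf
  simpa using this

/-- The time-frequency shift `M_w T_m` on `ℓ²(ℤⁿ)`. -/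
noncomputable def tfShift (z : Lat n × Tor n) (f : EllTwo n) : EllTwo n :=
  ⟨freqShift z.2 (timeShift z.1 f), by
    refine memℓp_gen ?_
    have h1 : Summable fun k => ‖f k‖ ^ (2 : ℝ≥0∞).toReal := (lp.memℓp f).summable (by norm_num)
    refine ((Equiv.subRight z.1).summable_iff.mpr h1).congr fun k => ?_
    simp [freqShift, timeShift, norm_mFourier_apply]⟩

theorem tfShift_apply (z : Lat n × Tor n) (f : EllTwo n) (k : Lat n) :
    tfShift z f k = freqShift z.2 (timeShift z.1 f) k := rfl

theorem enorm_mFourier_mul (k : Lat n) (w : Tor n) (c : ℂ) :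
    ‖UnitAddTorus.mFourier k w * c‖ₑ = ‖c‖ₑ := by
  rw [← ofReal_norm, norm_mul, norm_mFourier_apply, one_mul, ofReal_norm]

theorem norm_tfShift (z : Lat n × Tor n) (f : EllTwo n) : ‖tfShift z f‖ = ‖f‖ := by
  have h : ‖tfShift z f‖ₑ ^ 2 = ‖f‖ₑ ^ 2 := by
    rw [enorm_sq_eq_tsum, enorm_sq_eq_tsum, ← (Equiv.subRight z.1).tsum_eq fun k => ‖f k‖ₑ ^ 2]
    simp only [tfShift_apply, freqShift, timeShift, enorm_mFourier_mul, Equiv.subRight_apply]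
  have h2 := congrArg ENNReal.toReal h
  simp only [ENNReal.toReal_pow, toReal_enorm] at h2
  exact (sq_eq_sq₀ (norm_nonneg _) (norm_nonneg _)).mp h2

theorem tfShift_sub (z : Lat n × Tor n) (f g : EllTwo n) :
    tfShift z (f - g) = tfShift z f - tfShift z g := by
  refine lp.ext (funext fun k => ?_)
  simp [tfShift_apply, freqShift, timeShift, mul_sub]

theorem tfShift_sum (z : Lat n × Tor n) (s : Finset (Lat n)) (f : Lat n → EllTwo n) :
    tfShift z (∑ i ∈ s, f i) = ∑ i ∈ s, tfShift z (f i) := by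
  refine lp.ext (funext fun k => ?_)
  rw [tfShift_apply, freqShift, timeShift, lp.coeFn_sum, lp.coeFn_sum, Finset.sum_apply,
    Finset.sum_apply, Finset.mul_sum]
  rfl

theorem tfShift_single (m : Lat n) (w : Tor n) (k : Lat n) (c : ℂ) :
    tfShift (m, w) (lp.single 2 k c) =
      UnitAddTorus.mFourier (k + m) w • lp.single 2 (k + m) c := by
  refine lp.ext (funext fun l => ?_)
  rw [tfShift_apply, freqShift, timeShift, lp.coeFn_smul, Pi.smul_apply, smul_eq_mul]
  by_cases h : l = k + m
  · subst h
    simp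
  · have h' : l - m ≠ k := fun h' => h (by rw [← h', sub_add_cancel])
    simp [lp.single_apply, h, h']

/-- On finitely supported vectors continuity is explicit; since shifts are isometric, approximating
`f` by these is uniform in the shift. This makes the operator-valued integrand strongly measurable.
-/
theorem continuous_tfShift (f : EllTwo n) : Continuous fun z : Lat n × Tor n => tfShift z f := by
  refine continuous_prod_of_discrete_left.mpr fun m => ?_
  refine continuous_of_uniform_approx_of_continuous fun u hu => ?_
  obtain ⟨ε, hε, hu⟩ := Metric.mem_uniformity_dist.mp hu
  have hs := lp.hasSum_single (p := 2) (by norm_num) f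
  obtain ⟨s, hs⟩ := (hs.eventually (Metric.ball_mem_nhds f hε)).exists
  refine ⟨fun w => tfShift (m, w) (∑ i ∈ s, lp.single 2 i (f i)), ?_, fun w => hu ?_⟩
  · simp only [tfShift_sum, tfShift_single]
    exact continuous_finsetSum _ fun i _ =>
      (UnitAddTorus.mFourier (i + m)).continuous.smul continuous_const
  · rw [dist_eq_norm, ← tfShift_sub, norm_tfShift, ← dist_eq_norm, dist_comm]
    exact hs

theorem hasSum_stft (g f : EllTwo n) (z : Lat n × Tor n) :
    HasSum (fun k => f k * conj (freqShift z.2 (timeShift z.1 g) k)) (inner ℂ (tfShift z g) f) :=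
  lp.hasSum_inner (tfShift z g) f

theorem stft_eq_inner (g f : EllTwo n) (z : Lat n × Tor n) :
    stft g f z = inner ℂ (tfShift z g) f :=
  (hasSum_stft g f z).tsum_eq

theorem norm_stft_le (g f : EllTwo n) (z : Lat n × Tor n) : ‖stft g f z‖ ≤ ‖g‖ * ‖f‖ := by
  rw [stft_eq_inner, ← norm_tfShift z g]
  exact norm_inner_le_norm _ _

end EllTwo

/-! ### The embedding of `M^Φ` into `ℓ²` -/

section OrliczEmbedding

variable {n : ℕ} {γ g : Lat n → ℂ}

theorem continuous_stft (hγ : IsSchwartzLat γ) (hg : IsTemperedLat g) : Continuous (stft γ g) :=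
  continuous_prod_of_discrete_left.mpr fun m =>
    (continuous_fourierSum (summable_norm_mul_conj_shift hγ hg m)).congr fun w =>
      (stft_eq_fourierSum γ g m w).symm

/-- Orthogonality relation (Moyal's identity) for the short-time Fourier transform. -/
theorem lintegral_enorm_stft_sq (hγ : IsSchwartzLat γ) (hg : IsTemperedLat g) :
    ∫⁻ z, ‖stft γ g z‖ₑ ^ 2 ∂(phaseMeasure n) = (∑' k, ‖g k‖ₑ ^ 2) * ∑' k, ‖γ k‖ₑ ^ 2 := by
  rw [lintegral_phaseMeasure ((continuous_stft hγ hg).measurable.enorm.pow_const 2)]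
  simp_rw [stft_eq_fourierSum,
    lintegral_enorm_fourierSum_sq (summable_norm_mul_conj_shift hγ hg _)]
  -- Parseval on each fibre leaves `∑_m ∑_k |g(k)|² |γ(k - m)|²`; summing over `m` first separates
  -- the factors.
  rw [ENNReal.tsum_comm, ← ENNReal.tsum_mul_right]
  refine tsum_congr fun k => ?_
  rw [← (Equiv.subLeft k).tsum_eq fun j => ‖γ j‖ₑ ^ 2, ← ENNReal.tsum_mul_left]
  refine tsum_congr fun m => ?_
  rw [enorm_mul, mul_pow, Equiv.subLeft_apply, ← ofReal_norm (conj _), RCLike.norm_conj,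
    ofReal_norm]

theorem eLpNorm_two_count (f : EllTwo n) : eLpNorm f 2 Measure.count = ‖f‖ₑ := by
  rw [eLpNorm_eq_lintegral_rpow_enorm_toReal (by norm_num) (by norm_num), lintegral_count]
  simp only [ENNReal.toReal_ofNat, ENNReal.rpow_ofNat]
  rw [← enorm_sq_eq_tsum, ← ENNReal.rpow_ofNat, ← ENNReal.rpow_mul]
  norm_num

theorem memℓp_of_isSchwartzLat (hγ : IsSchwartzLat γ) : Memℓp γ 2 := by
  have h1 : Memℓp γ 1 := memℓp_gen (by simpa using hγ.summable_norm)
  exact h1.of_exponent_ge (by norm_num)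

variable {Φ : ℝ≥0∞ → ℝ≥0∞} {b : ℝ}

/-- On one fibre, of mass `1`, the tangent line bounds the mean of `2t |V_γ g| / b` by `1 + t²/2 ≤
2`, and a Fourier coefficient is at most the mean modulus. -/
theorem norm_mul_le_of_lintegral_le (hγ : IsSchwartzLat γ) (hg : IsTemperedLat g) (hΦ : IsYoung Φ)
    (he : IsEntropyLike Φ) (hb : 0 < b)
    (hI : ∫⁻ z, Φ (ENNReal.ofReal (‖stft γ g z‖ / b)) ∂(phaseMeasure n) ≤ 1) (k j : Lat n) :
    ‖g k‖ * ‖γ j‖ ≤ b / thr := by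
  have ht := thr_pos
  have hcont := continuous_stft hγ hg
  -- On this fibre the coefficient at `k` is `g(k) conj γ(j)`.
  obtain ⟨m, hm⟩ : ∃ m, k - m = j := ⟨k - j, sub_sub_cancel k j⟩
  let L : Lat n × Tor n → ℝ≥0∞ := fun z =>
    ENNReal.ofReal (2 * thr * (‖stft γ g z‖ / b) - thr ^ 2 / 2)
  have hLm : Measurable L := by
    have : Continuous L := ENNReal.continuous_ofReal.comp (by fun_prop)
    exact this.measurable
  have h1 : ∫⁻ w, L (m, w) ∂(torusMeasure n) ≤ 1 := by
    refine (ENNReal.le_tsum (f := fun m => ∫⁻ w, L (m, w) ∂(torusMeasure n)) m).trans ?_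
    rw [← lintegral_phaseMeasure hLm]
    exact (lintegral_mono fun z => he.ofReal_linear_le hΦ (by positivity)).trans hI
  have h2 : ENNReal.ofReal (2 * thr / b * (‖g k‖ * ‖γ j‖)) ≤ 2 := by
    calc ENNReal.ofReal (2 * thr / b * (‖g k‖ * ‖γ j‖))
        = ENNReal.ofReal (2 * thr / b) * ‖g k * conj (γ (k - m))‖ₑ := by
          rw [ENNReal.ofReal_mul (by positivity), ← ofReal_norm, norm_mul, RCLike.norm_conj, hm]
      _ ≤ ENNReal.ofReal (2 * thr / b) * ∫⁻ w, ‖stft γ g (m, w)‖ₑ ∂(torusMeasure n) := by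
          simp_rw [stft_eq_fourierSum]
          gcongr
          exact enorm_le_lintegral_fourierSum (summable_norm_mul_conj_shift hγ hg m) k
      _ = ∫⁻ w, ENNReal.ofReal (2 * thr / b) * ‖stft γ g (m, w)‖ₑ ∂(torusMeasure n) :=
          (lintegral_const_mul' _ _ ENNReal.ofReal_ne_top).symm
      _ ≤ ∫⁻ w, (L (m, w) + ENNReal.ofReal (thr ^ 2 / 2)) ∂(torusMeasure n) := by
          refine lintegral_mono fun w => ?_
          rw [← ofReal_norm, ← ENNReal.ofReal_mul (by positivity)]
          refine le_trans (ENNReal.ofReal_le_ofReal (le_of_eq ?_)) ENNReal.ofReal_add_le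
          ring
      _ ≤ 1 + 1 := by
          rw [lintegral_add_right _ measurable_const, lintegral_const, measure_univ, mul_one]
          refine add_le_add h1 (ENNReal.ofReal_le_one.mpr ?_)
          nlinarith [thr_lt]
      _ = 2 := one_add_one_eq_two
  rw [← ENNReal.ofReal_ofNat, ENNReal.ofReal_le_ofReal_iff (by norm_num)] at h2
  rw [le_div_iff₀ ht]
  have h3 : 2 * thr / b * (‖g k‖ * ‖γ j‖) = 2 * (‖g k‖ * ‖γ j‖ * thr) / b := by ring
  rw [h3, div_le_iff₀ hb] at h2
  linarith

/-- Fixing `j` with `γ j ≠ 0` bounds `g`, and `γ` is summable. Only finiteness of the bound matters.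
-/
theorem exists_norm_stft_le (hγ : IsSchwartzLat γ) (hγ0 : γ ≠ 0) (hg : IsTemperedLat g)
    (hΦ : IsYoung Φ) (he : IsEntropyLike Φ) (hb : 0 < b)
    (hI : ∫⁻ z, Φ (ENNReal.ofReal (‖stft γ g z‖ / b)) ∂(phaseMeasure n) ≤ 1) :
    ∃ C, ∀ z, ‖stft γ g z‖ ≤ C := by
  obtain ⟨j, hj⟩ := Function.ne_iff.mp hγ0
  have hj' : 0 < ‖γ j‖ := norm_pos_iff.mpr hj
  refine ⟨∑' k, b / thr / ‖γ j‖ * ‖γ k‖, fun ⟨m, w⟩ => ?_⟩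
  rw [stft_eq_fourierSum]
  have hs := summable_norm_mul_conj_shift hγ hg m
  have hn := fun k => norm_mul_conj_mFourier (fun k => g k * conj (γ (k - m))) k w
  calc ‖fourierSum (fun k => g k * conj (γ (k - m))) w‖
      ≤ ∑' k, ‖g k * conj (γ (k - m))‖ := by
        refine (norm_tsum_le_tsum_norm ?_).trans (le_of_eq ?_)
        · simpa only [hn] using hs
        · simp only [hn]
    _ ≤ ∑' k, b / thr / ‖γ j‖ * ‖γ (k - m)‖ := by
        refine hs.tsum_le_tsum (fun k => ?_)
          (((Equiv.subRight m).summable_iff.mpr hγ.summable_norm).mul_left _)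
        rw [norm_mul, RCLike.norm_conj]
        gcongr
        rw [le_div_iff₀ hj']
        exact norm_mul_le_of_lintegral_le hγ hg hΦ he hb hI k j
    _ = _ := (Equiv.subRight m).tsum_eq fun k => b / thr / ‖γ j‖ * ‖γ k‖

/-- A bootstrap: the crude pointwise bound gives `g ∈ ℓ²`, after which Cauchy–Schwarz supplies a
pointwise bound tied to the `L²` norm itself. -/
theorem tsum_mul_tsum_le_of_lintegral_le (hγ : IsSchwartzLat γ) (hγ0 : γ ≠ 0)
    (hg : IsTemperedLat g) (hΦ : IsYoung Φ) (he : IsEntropyLike Φ) (hb : 0 < b)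
    (hI : ∫⁻ z, Φ (ENNReal.ofReal (‖stft γ g z‖ / b)) ∂(phaseMeasure n) ≤ 1) :
    (∑' k, ‖g k‖ₑ ^ 2) * ∑' k, ‖γ k‖ₑ ^ 2 ≤ ENNReal.ofReal ((kap * b) ^ 2) := by
  have ht := thr_pos
  set T := ∫⁻ z, ENNReal.ofReal ((‖stft γ g z‖ / b) ^ 2) ∂(phaseMeasure n) with hT
  have hST : (∑' k, ‖g k‖ₑ ^ 2) * ∑' k, ‖γ k‖ₑ ^ 2 = ENNReal.ofReal (b ^ 2) * T := by
    rw [← lintegral_enorm_stft_sq hγ hg, hT, ← lintegral_const_mul' _ _ ENNReal.ofReal_ne_top]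
    refine lintegral_congr fun z => ?_
    rw [← ENNReal.ofReal_mul (by positivity), ← ofReal_norm, ← ENNReal.ofReal_pow (norm_nonneg _)]
    congr 1
    field_simp
  have key : ∀ N : ℝ, thr ≤ N → (∀ z, ‖stft γ g z‖ / b ≤ N) →
      ENNReal.ofReal (2 * thr * N - thr ^ 2 / 2) * T ≤ ENNReal.ofReal (N ^ 2) := by
    intro N hN hz
    rw [hT, ← lintegral_const_mul' _ _ ENNReal.ofReal_ne_top]
    calc _ ≤ ∫⁻ z, ENNReal.ofReal (N ^ 2) * Φ (ENNReal.ofReal (‖stft γ g z‖ / b))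
          ∂(phaseMeasure n) :=
          lintegral_mono fun z => he.mul_sq_le hΦ (by positivity) (hz z) hN
      _ = ENNReal.ofReal (N ^ 2) * _ := lintegral_const_mul' _ _ ENNReal.ofReal_ne_top
      _ ≤ ENNReal.ofReal (N ^ 2) * 1 := by gcongr
      _ = _ := mul_one _
  have hTtop : T ≠ ⊤ := by
    obtain ⟨C, hC⟩ := exists_norm_stft_le hγ hγ0 hg hΦ he hb hI
    have h := key (max thr (C / b)) (le_max_left _ _)
      fun z => le_max_of_le_right (by gcongr; exact hC z)
    intro htop
    have hpos : ENNReal.ofReal (2 * thr * max thr (C / b) - thr ^ 2 / 2) ≠ 0 := by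
      rw [ne_eq, ENNReal.ofReal_eq_zero, not_le]
      nlinarith [le_max_left thr (C / b)]
    rw [htop, ENNReal.mul_top hpos, top_le_iff] at h
    exact ENNReal.ofReal_ne_top h
  have hγS : ∑' k, ‖γ k‖ₑ ^ 2 ≠ 0 := by
    obtain ⟨j, hj⟩ := Function.ne_iff.mp hγ0
    intro h0
    have := ENNReal.tsum_eq_zero.mp h0 j
    simp at this
    exact hj this
  have hgS : ∑' k, ‖g k‖ₑ ^ 2 ≠ ⊤ := by
    intro htop
    rw [htop, ENNReal.top_mul hγS] at hST
    exact ENNReal.mul_ne_top ENNReal.ofReal_ne_top hTtop hST.symm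
  let g' : EllTwo n := ⟨g, memℓp_two_of_tsum_ne_top hgS⟩
  let γ' : EllTwo n := ⟨γ, memℓp_of_isSchwartzLat hγ⟩
  -- Both the `L²` norm (Moyal) and a pointwise bound (Cauchy–Schwarz) of `V_γ g / b`.
  set R : ℝ := ‖γ'‖ * ‖g'‖ / b with hR
  have hR0 : 0 ≤ R := by positivity
  have hTR : T = ENNReal.ofReal (R ^ 2) := by
    have e1 : (∑' k, ‖g k‖ₑ ^ 2) = ‖g'‖ₑ ^ 2 := (enorm_sq_eq_tsum g').symm
    have e2 : (∑' k, ‖γ k‖ₑ ^ 2) = ‖γ'‖ₑ ^ 2 := (enorm_sq_eq_tsum γ').symm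
    have hb2 : ENNReal.ofReal (b ^ 2) ≠ 0 := by
      rw [ne_eq, ENNReal.ofReal_eq_zero, not_le]; positivity
    rw [← ENNReal.mul_right_inj hb2 ENNReal.ofReal_ne_top, ← hST, e1, e2,
      ← ENNReal.ofReal_mul (by positivity), ← ofReal_norm, ← ofReal_norm,
      ← ENNReal.ofReal_pow (norm_nonneg _), ← ENNReal.ofReal_pow (norm_nonneg _),
      ← ENNReal.ofReal_mul (by positivity)]
    congr 1
    rw [hR]
    field_simp
  have hRk : R ≤ kap := by
    rcases le_total R thr with h | h
    · exact h.trans thr_lt_kap.le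
    · have hk := key R h fun z => by
        rw [hR]
        gcongr
        exact norm_stft_le γ' g' z
      have hRpos : 0 < R := ht.trans_le h
      have hc : 0 ≤ 2 * thr * R - thr ^ 2 / 2 := by nlinarith
      rw [hTR, ← ENNReal.ofReal_mul hc, ENNReal.ofReal_le_ofReal_iff (by positivity)] at hk
      have h1 : 2 * thr * R - thr ^ 2 / 2 ≤ 1 := by
        have hR2 : 0 < R ^ 2 := by positivity
        exact le_of_mul_le_mul_right (by linarith) hR2
      have := kap_eq
      nlinarith
  rw [hST, hTR, ← ENNReal.ofReal_mul (by positivity)]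
  refine ENNReal.ofReal_le_ofReal ?_
  rw [mul_pow, mul_comm]
  gcongr

/-- `M^Φ(ℤⁿ)` embeds into `ℓ²(ℤⁿ)` for entropy-like Young functions `Φ`. -/
theorem exists_ellTwo_of_memOrliczMod (hγ : IsSchwartzLat γ) (hγ0 : γ ≠ 0)
    (hΦ : IsYoung Φ) (he : IsEntropyLike Φ) (hg : MemOrliczMod Φ γ g) :
    ∃ g' : EllTwo n, (g' : Lat n → ℂ) = g ∧
      ‖g'‖ₑ * eLpNorm γ 2 Measure.count ≤ ENNReal.ofReal kap * orliczModNorm Φ γ g := by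
  obtain ⟨hgt, hfin⟩ := hg
  have hkap : 0 < kap := thr_pos.trans thr_lt_kap
  let γ' : EllTwo n := ⟨γ, memℓp_of_isSchwartzLat hγ⟩
  have e2 : (∑' k, ‖γ k‖ₑ ^ 2) = ‖γ'‖ₑ ^ 2 := (enorm_sq_eq_tsum γ').symm
  have hγnorm : eLpNorm γ 2 Measure.count = ‖γ'‖ₑ := eLpNorm_two_count γ'
  have hb : ∀ β : ℝ≥0∞, 0 < β → β ≠ ⊤ → ∫⁻ z, Φ (‖stft γ g z‖ₑ / β) ∂(phaseMeasure n) ≤ 1 →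
      (∑' k, ‖g k‖ₑ ^ 2) * ∑' k, ‖γ k‖ₑ ^ 2 ≤ (ENNReal.ofReal kap * β) ^ 2 := by
    intro β h0 htop hI
    have hβ : 0 < β.toReal := ENNReal.toReal_pos h0.ne' htop
    have hI' : ∫⁻ z, Φ (ENNReal.ofReal (‖stft γ g z‖ / β.toReal)) ∂(phaseMeasure n) ≤ 1 := by
      refine le_trans (le_of_eq (lintegral_congr fun z => ?_)) hI
      rw [ENNReal.ofReal_div_of_pos hβ, ofReal_norm, ENNReal.ofReal_toReal htop]
    refine (tsum_mul_tsum_le_of_lintegral_le hγ hγ0 hgt hΦ he hβ hI').trans (le_of_eq ?_)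
    rw [ENNReal.ofReal_pow (by positivity), ENNReal.ofReal_mul hkap.le, ENNReal.ofReal_toReal htop]
  have hγS : ∑' k, ‖γ k‖ₑ ^ 2 ≠ 0 := by
    obtain ⟨j, hj⟩ := Function.ne_iff.mp hγ0
    intro h0
    have := ENNReal.tsum_eq_zero.mp h0 j
    simp at this
    exact hj this
  have hgS : ∑' k, ‖g k‖ₑ ^ 2 ≠ ⊤ := by
    obtain ⟨β, ⟨h0, hI⟩, hβ⟩ := sInf_lt_iff.mp hfin
    intro htop
    have h := hb β h0 hβ.ne hI
    rw [htop, ENNReal.top_mul hγS, top_le_iff] at h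
    exact ENNReal.pow_ne_top (ENNReal.mul_ne_top ENNReal.ofReal_ne_top hβ.ne) h
  let g' : EllTwo n := ⟨g, memℓp_two_of_tsum_ne_top hgS⟩
  have e1 : (∑' k, ‖g k‖ₑ ^ 2) = ‖g'‖ₑ ^ 2 := (enorm_sq_eq_tsum g').symm
  refine ⟨g', rfl, ?_⟩
  have hk0 : ENNReal.ofReal kap ≠ 0 := by simpa using hkap
  rw [hγnorm, mul_comm (ENNReal.ofReal kap),
    ← ENNReal.div_le_iff_le_mul (.inl hk0) (.inl ENNReal.ofReal_ne_top)]
  -- After division by `κ` the bound, valid for each admissible `β`, passes to the infimum.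
  refine le_sInf fun β ⟨h0, hI⟩ => ?_
  by_cases htop : β = ⊤
  · simp [htop]
  have h := hb β h0 htop hI
  rw [e1, e2, ← mul_pow] at h
  rw [ENNReal.div_le_iff_le_mul (.inl hk0) (.inl ENNReal.ofReal_ne_top), mul_comm β]
  exact (ENNReal.pow_le_pow_left_iff two_ne_zero).mp h

end OrliczEmbedding

/-! ### The localization operator as an operator integral -/

section LocalizationOperator

variable {n : ℕ} {ς : Lat n × Tor n → ℂ}

/-- The localization operator with integrable symbol `ς` and both windows equal to `g`. -/
noncomputable def locOp (ς : Lat n × Tor n → ℂ) (g : EllTwo n) : EllTwo n →L[ℂ] EllTwo n :=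
  ∫ z, ς z • (InnerProductSpace.rankOne ℂ (tfShift z g) (tfShift z g) : EllTwo n →L[ℂ] EllTwo n)
    ∂(phaseMeasure n)

theorem isLocalizationOperator_locOp (hς : Integrable ς (phaseMeasure n)) (g : EllTwo n) :
    IsLocalizationOperator ς g g (locOp ς g) := by
  intro f
  refine ⟨fun m w => (hasSum_stft g f (m, w)).summable, fun k => ?_⟩
  have hI := integrable_smul_rankOne (continuous_tfShift g).aestronglyMeasurable hς
    fun z => (norm_tfShift z g).le
  -- The `k`-th coordinate of `A f` is a continuous functional of `A`, so the operator integral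
  -- gives the pointwise formula, integrability included.
  let ev : (EllTwo n →L[ℂ] EllTwo n) →L[ℂ] ℂ :=
    (lp.evalCLM ℂ (fun _ : Lat n => ℂ) (p := 2) k).comp (ContinuousLinearMap.apply ℂ (EllTwo n) f)
  have hev : ∀ z, ev (ς z • (InnerProductSpace.rankOne ℂ (tfShift z g) (tfShift z g) :
      EllTwo n →L[ℂ] EllTwo n)) = ς z * stft g f z * freqShift z.2 (timeShift z.1 g) k := by
    intro z
    rw [stft_eq_inner, mul_assoc]
    rfl
  refine ⟨(ev.integrable_comp hI).congr (.of_forall hev), ?_⟩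
  exact (ev.integral_comp_comm hI).symm.trans (integral_congr_ae (.of_forall hev))

theorem schattenNorm_locOp_le (hς : Integrable ς (phaseMeasure n)) (g : EllTwo n) {p : ℝ≥0∞}
    (hp : 1 ≤ p) : IsCompactOperator (locOp ς g) ∧
      schattenNorm p (locOp ς g) ≤ (∫⁻ z, ‖ς z‖ₑ ∂(phaseMeasure n)) * ‖g‖ₑ ^ 2 := by
  have h := memSchatten_integral_rankOne (continuous_tfShift g).aestronglyMeasurable hς
    (fun z => (norm_tfShift z g).le) hp
  refine ⟨h.1, h.2.trans (le_of_eq ?_)⟩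
  rw [ENNReal.ofReal_mul (integral_nonneg fun _ => norm_nonneg _),
    ofReal_integral_norm_eq_lintegral_enorm hς, ENNReal.ofReal_pow (norm_nonneg _), ofReal_norm]

end LocalizationOperator

end LocOp

/-! ### Assembling the theorem -/

open LocOp in
theorem mainTheorem3 (n : ℕ)
    (γ : Lat n → ℂ) (hγ : IsSchwartzLat γ) (hγ0 : γ ≠ 0)
    (G : Lat n × Tor n → ℂ) (hG : IsSchwartzPhase G) (hG0 : G ≠ 0)
    (Φ : ℝ≥0∞ → ℝ≥0∞) (hΦ : IsYoung Φ) (hΦe : IsEntropyLike Φ)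
    (ς : Lat n × Tor n → ℂ) (hς : MemModPhase 1 G ς)
    (g : Lat n → ℂ) (hg : MemOrliczMod Φ γ g) :
    ∃ A : EllTwo n →L[ℂ] EllTwo n, IsLocalizationOperator ς g g A ∧
      ∀ p : ℝ≥0∞, 1 ≤ p →
        MemSchatten p A ∧
        schattenNorm p A ≤ (2 : ℝ≥0∞) ^ (2 / p).toReal *
          (windowConst γ G * modNormPhase 1 G ς * orliczModNorm Φ γ g ^ 2) := by
  obtain ⟨g', rfl, hg'⟩ := exists_ellTwo_of_memOrliczMod hγ hγ0 hΦ hΦe hg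
  have hL1 := lintegral_mul_iSup_enorm_le_modNormPhase hς.1 hG
  have hmod : modNormPhase 1 G ς ≠ ⊤ := hς.2.2.ne
  have hG1 : ⨆ z, ‖G z‖ₑ ≠ 0 := by
    obtain ⟨z, hz⟩ := Function.ne_iff.mp hG0
    intro h
    have := (le_iSup (fun z => ‖G z‖ₑ) z).trans h.le
    simp at this
    exact hz this
  have hG2 : ⨆ z, ‖G z‖ₑ ≠ ⊤ := by
    obtain ⟨C, hC⟩ := hG.exists_bound 0
    refine ne_top_of_le_ne_top (ENNReal.ofReal_ne_top (r := C)) (iSup_le fun z => ?_)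
    rw [← ofReal_norm]
    exact ENNReal.ofReal_le_ofReal (by simpa using hC z)
  have hL1' : ∫⁻ z, ‖ς z‖ₑ ∂(phaseMeasure n) ≤ modNormPhase 1 G ς / ⨆ z, ‖G z‖ₑ :=
    (ENNReal.le_div_iff_mul_le (.inl hG1) (.inl hG2)).mpr hL1
  have hint : Integrable ς (phaseMeasure n) :=
    ⟨hς.1.aestronglyMeasurable, hL1'.trans_lt (ENNReal.div_lt_top hmod hG1)⟩
  have hγ1 : eLpNorm γ 2 Measure.count ≠ 0 := by
    intro h
    rw [eLpNorm_eq_zero_iff (Measurable.of_discrete.aestronglyMeasurable) (by norm_num)] at h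
    exact hγ0 (funext (Measure.ae_count_iff.mp h))
  have hγ2 : eLpNorm γ 2 Measure.count ≠ ⊤ := by
    have h := eLpNorm_two_count (⟨γ, memℓp_of_isSchwartzLat hγ⟩ : EllTwo n)
    exact ne_of_eq_of_ne h enorm_ne_top
  have hgle : ‖g'‖ₑ ≤ ENNReal.ofReal kap * orliczModNorm Φ γ g' / eLpNorm γ 2 Measure.count :=
    (ENNReal.le_div_iff_mul_le (.inl hγ1) (.inl hγ2)).mpr hg'
  refine ⟨locOp ς g', isLocalizationOperator_locOp hint g', fun p hp => ?_⟩
  obtain ⟨hc, hs⟩ := schattenNorm_locOp_le hint g' hp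
  refine ⟨⟨hc, hs.trans_lt (ENNReal.mul_lt_top hint.2 (by finiteness))⟩, hs.trans ?_⟩
  calc (∫⁻ z, ‖ς z‖ₑ ∂(phaseMeasure n)) * ‖g'‖ₑ ^ 2
      ≤ (modNormPhase 1 G ς / ⨆ z, ‖G z‖ₑ) *
        (ENNReal.ofReal kap * orliczModNorm Φ γ g' / eLpNorm γ 2 Measure.count) ^ 2 := by gcongr
    _ = windowConst γ G * modNormPhase 1 G ς * orliczModNorm Φ γ g' ^ 2 := by
        simp only [windowConst, kap, div_eq_mul_inv, mul_pow]
        ring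
    -- The estimate already holds with constant `1` for every `p`; the factor `2 ^ (2/p) ≥ 1` is
    -- slack.
    _ ≤ _ := le_mul_of_one_le_left' (by
        simpa using ENNReal.rpow_le_rpow_of_exponent_le (x := 2) one_le_two
          (ENNReal.toReal_nonneg (a := 2 / p)))
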